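/- Let $q$ be a prime power and write $\sqrt q$ for its positive square root. For $g\ge 1$ let $W_q(g)$ be the set of monic polynomials in $\mathbb Z[x]$ of degree $2g$ whose complex roots, listed with multiplicity, are $w_1,\overline{w_1},\dots,w_g,\overline{w_g}$ for some complex numbers $w_i$ with $|w_i|=\sqrt q$. Let $$h(x)=x^{10}+a_1x^9+a_2x^8+a_3x^7+a_4x^6+a_5x^5+a_4qx^4+a_3q^2x^3+a_2q^3x^2+a_1q^4x+q^5$$ with $a_1,\dots,a_5\in\mathbb Z$. Consider the inequalities (a) $|a_1|\le 10\sqrt q$; (b*) $8\sqrt q\,|a_1|-35q\le a_2$; (b) $a_2\le \frac25a_1^2+5q$; (c) $-\frac4{25}a_1^3+\frac35a_1a_2+qa_1-\frac1{50}(4a_1^2+50q-10a_2)^{3/2}\le a_3\le -\frac4{25}a_1^3+\frac35a_1a_2+qa_1+\frac1{50}(4a_1^2+50q-10a_2)^{3/2}$, where the quantity in parentheses is non-negative by (b); (d) $-6\sqrt q\,a_2-20qa_1-50q\sqrt q\le a_3\le 6\sqrt q\,a_2-20qa_1+50q\sqrt q$; (e) $B+5\theta_1\le a_4\le B+5\theta_2$,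 where $B=\frac{3a_1^4}{125}-\frac{3a_1^2a_2}{25}-qa_1^2+\frac{2a_1a_3}{5}+3qa_2-5q^2$; (f) $4\sqrt q\,|4qa_1+a_3|-9qa_2-25q^2\le a_4$; (g) $-2\sqrt q\,a_4-2qa_3-2q\sqrt q\,a_2-2q^2a_1-2q^2\sqrt q\le a_5\le 2\sqrt q\,a_4-2qa_3+2q\sqrt q\,a_2-2q^2a_1+2q^2\sqrt q$; (h) $\Lambda_1+A\le a_5\le\Lambda_2+A$, where $A=-\frac{4a_1^5}{3125}+\frac{a_1^3(a_2+15q)}{125}-\frac{a_1^2a_3}{25}-\frac{a_1(3a_2q-a_4+5q^2)}{5}+2qa_3$. Here "(a)–(d)", "(a)–(f)" and "(a)–(h)" include (b*), and $\theta_1,\theta_2,\Lambda_1,\Lambda_2$ are defined as follows. Put $$u_2=-\tfrac{3a_1^2}{25}+\tfrac{3a_2}{10}-\tfrac{3q}{2},\qquad u_3=\tfrac{2a_1^3}{125}-\tfrac{3a_1a_2}{50}-\tfrac{qa_1}{10}+\tfrac{a_3}{10},$$ $$u_4=-\tfrac{3a_1^4}{625}+\tfrac{3a_1^2a_2}{125}+\tfrac{qa_1^2}{5}-\tfrac{2a_1a_3}{25}-\tfrac{3qa_2}{5}+\tfrac{a_4}{5}+q^2,\qquad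 \Delta=u_3^2+\tfrac4{27}u_2^3.$$ Fix any complex square root $\sqrt\Delta$, any primitive third root of unity $\zeta$ and any complex third root $\omega$ of $\frac12(-u_3+\sqrt\Delta)$, and let $S$ be the multiset of the three numbers $$-\zeta^k\omega\left(\tfrac{9u_3}2+\tfrac{3\sqrt\Delta}2\right)-\zeta^{-k}\overline\omega\left(\tfrac{9u_3}2-\tfrac{3\sqrt\Delta}2\right)+\tfrac{2u_2^2}3\qquad(k=0,1,2).$$ For $i_1,i_2\in\{1,-1\}$ let $$x_{i_1,i_2}=i_1\sqrt{-u_2+i_2\sqrt{u_2^2-u_4}}\quad\text{if }u_3=0,\qquad x_{i_1,i_2}=\frac{i_1\sqrt{2y}+i_2\sqrt{-4u_2-2y-i_1\frac{8u_3}{\sqrt{2y}}}}2\quad\text{if }u_3\ne0,$$ where $v_2=-\frac{u_2^2}3-u_4$, $v_3=\frac{2u_2u_4}3-\frac{2u_2^3}{27}-2u_3^2$, $C$ is a complex third root of $-v_3$ if $v_2=0$ and of $\frac12\left(-v_3+\sqrt{v_3^2+\frac4{27}v_2^3}\right)$ if $v_2\neq0$, and $y=C-\frac{v_2}{3C}-\frac{2u_2}3$,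 the term $\frac{v_2}{3C}$ being read as $0$ if $v_2=0$. All square and third roots here are arbitrary complex roots, each chosen once (so each outer square root depends only on the sign, $i_2$ or $i_1$, under it). Then, for every choice of the roots: 1. If $h\in W_q(5)$, or if (a)–(d) hold, then the elements of $S$, with multiplicity, are real numbers $\theta_1\le\theta_2\le\theta_3$. 2. If $h\in W_q(5)$, or if (a)–(f) hold, then the four numbers $x_{i_1,i_2}$, with multiplicity, are real numbers $\gamma_1\le\gamma_2\le\gamma_3\le\gamma_4$. Then define $$\Lambda_1=\max\{H(\gamma_1),H(\gamma_3)\},\quad \Lambda_2=\min\{H(\gamma_2),H(\gamma_4)\},\quad H(x)=-x^5-\tfrac{10}3u_2x^3-10u_3x^2-5u_4x.$$ 3. $h\in W_q(5)$ if and only if (a)–(h) hold. 4. If $h\in W_q(5)$, then $h$ has a real root if and only if at least one of the inequalities in (a), (b*), (d), (f), (g) is an equality. 5. $h\in W_q(5)$ and $h$ has a real root if and only if one of the following mutually exclusive cases occurs: (I) $q$ is a square and $h(x)=(x+\sqrt q)^2h_0(x)$ or $h(x)=(x-\sqrt q)^2h_0(x)$ with $h_0\in W_q(4)$; (II) $q$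 is not a square and $h(x)=(x^2-q)^2h_0(x)$ with $h_0\in W_q(3)$. -/

import Mathlib

open Polynomial

noncomputable section

/-- `W_q(g)`: the set of `q`-Weil polynomials of degree `2g`, that is, monic integer polynomials of
positive degree `2g` whose complex roots, listed with multiplicity, are
`w₁, conj w₁, …, w_g, conj w_g` with `|w_i| = √q`. -/
def WeilPolys (q g : ℕ) : Set ℤ[X] :=
  {h | 0 < g ∧ h.Monic ∧ h.natDegree = 2 * g ∧
    ∃ w : Fin g → ℂ, (∀ i, ‖w i‖ = √(q : ℝ)) ∧
      h.aroots ℂ = ∑ i, ({w i, starRingEnd ℂ (w i)} : Multiset ℂ)}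

/-- The polynomial `x¹⁰ + a₁x⁹ + a₂x⁸ + a₃x⁷ + a₄x⁶ + a₅x⁵ + a₄qx⁴ + a₃q²x³ + a₂q³x² + a₁q⁴x + q⁵`. -/
def weilShape (q : ℕ) (a₁ a₂ a₃ a₄ a₅ : ℤ) : ℤ[X] :=
  X ^ 10 + C a₁ * X ^ 9 + C a₂ * X ^ 8 + C a₃ * X ^ 7 + C a₄ * X ^ 6 + C a₅ * X ^ 5
    + C (a₄ * q) * X ^ 4 + C (a₃ * q ^ 2) * X ^ 3 + C (a₂ * q ^ 3) * X ^ 2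
    + C (a₁ * q ^ 4) * X + C ((q : ℤ) ^ 5)

/-- `h` has a real root. -/
def HasRealRoot (h : ℤ[X]) : Prop := ∃ x : ℝ, aeval x h = 0

/-! ### The inequalities -/

def CondA (q a₁ : ℝ) : Prop := |a₁| ≤ 10 * √q

def CondBStar (q a₁ a₂ : ℝ) : Prop := 8 * √q * |a₁| - 35 * q ≤ a₂

def CondB (q a₁ a₂ : ℝ) : Prop := a₂ ≤ 2 / 5 * a₁ ^ 2 + 5 * q

/-- The quantity whose `3/2`-th power occurs in (c). -/
def radicandC (q a₁ a₂ : ℝ) : ℝ := 4 * a₁ ^ 2 + 50 * q - 10 * a₂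

def CondC (q a₁ a₂ a₃ : ℝ) : Prop :=
  -(4 / 25) * a₁ ^ 3 + 3 / 5 * a₁ * a₂ + q * a₁ - 1 / 50 * radicandC q a₁ a₂ ^ (3 / 2 : ℝ) ≤ a₃ ∧
  a₃ ≤ -(4 / 25) * a₁ ^ 3 + 3 / 5 * a₁ * a₂ + q * a₁ + 1 / 50 * radicandC q a₁ a₂ ^ (3 / 2 : ℝ)

def lowerD (q a₁ a₂ : ℝ) : ℝ := -6 * √q * a₂ - 20 * q * a₁ - 50 * q * √q

def upperD (q a₁ a₂ : ℝ) : ℝ := 6 * √q * a₂ - 20 * q * a₁ + 50 * q * √q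

def CondD (q a₁ a₂ a₃ : ℝ) : Prop := lowerD q a₁ a₂ ≤ a₃ ∧ a₃ ≤ upperD q a₁ a₂

/-- The inequalities (a), (b*), (b), (c), (d). -/
def CondsAToD (q a₁ a₂ a₃ : ℝ) : Prop :=
  CondA q a₁ ∧ CondBStar q a₁ a₂ ∧ CondB q a₁ a₂ ∧ CondC q a₁ a₂ a₃ ∧ CondD q a₁ a₂ a₃

def CondE (q a₁ a₂ a₃ a₄ θ₁ θ₂ : ℝ) : Prop :=
  3 * a₁ ^ 4 / 125 - 3 * a₁ ^ 2 * a₂ / 25 - q * a₁ ^ 2 + 2 * a₁ * a₃ / 5 + 3 * q * a₂ - 5 * q ^ 2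
      + 5 * θ₁ ≤ a₄ ∧
  a₄ ≤ 3 * a₁ ^ 4 / 125 - 3 * a₁ ^ 2 * a₂ / 25 - q * a₁ ^ 2 + 2 * a₁ * a₃ / 5 + 3 * q * a₂
      - 5 * q ^ 2 + 5 * θ₂

def lowerF (q a₁ a₂ a₃ : ℝ) : ℝ := 4 * √q * |4 * q * a₁ + a₃| - 9 * q * a₂ - 25 * q ^ 2

def CondF (q a₁ a₂ a₃ a₄ : ℝ) : Prop := lowerF q a₁ a₂ a₃ ≤ a₄

def lowerG (q a₁ a₂ a₃ a₄ : ℝ) : ℝ :=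
  -2 * √q * a₄ - 2 * q * a₃ - 2 * q * √q * a₂ - 2 * q ^ 2 * a₁ - 2 * q ^ 2 * √q

def upperG (q a₁ a₂ a₃ a₄ : ℝ) : ℝ :=
  2 * √q * a₄ - 2 * q * a₃ + 2 * q * √q * a₂ - 2 * q ^ 2 * a₁ + 2 * q ^ 2 * √q

def CondG (q a₁ a₂ a₃ a₄ a₅ : ℝ) : Prop :=
  lowerG q a₁ a₂ a₃ a₄ ≤ a₅ ∧ a₅ ≤ upperG q a₁ a₂ a₃ a₄

/-- At least one of the inequalities in (a), (b*), (d), (f), (g) is an equality. -/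
def SomeEquality (q a₁ a₂ a₃ a₄ a₅ : ℝ) : Prop :=
  |a₁| = 10 * √q ∨
  8 * √q * |a₁| - 35 * q = a₂ ∨
  (lowerD q a₁ a₂ = a₃ ∨ a₃ = upperD q a₁ a₂) ∨
  lowerF q a₁ a₂ a₃ = a₄ ∨
  (lowerG q a₁ a₂ a₃ a₄ = a₅ ∨ a₅ = upperG q a₁ a₂ a₃ a₄)

/-! ### The auxiliary real numbers -/

def u₂ (q a₁ a₂ : ℝ) : ℝ := -(3 * a₁ ^ 2 / 25) + 3 * a₂ / 10 - 3 * q / 2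

def u₃ (q a₁ a₂ a₃ : ℝ) : ℝ :=
  2 * a₁ ^ 3 / 125 - 3 * a₁ * a₂ / 50 - q * a₁ / 10 + a₃ / 10

def u₄ (q a₁ a₂ a₃ a₄ : ℝ) : ℝ :=
  -(3 * a₁ ^ 4 / 625) + 3 * a₁ ^ 2 * a₂ / 125 + q * a₁ ^ 2 / 5 - 2 * a₁ * a₃ / 25
    - 3 * q * a₂ / 5 + a₄ / 5 + q ^ 2

/-- The constant `A` of (h). -/
def constA (q a₁ a₂ a₃ a₄ : ℝ) : ℝ :=
  -(4 * a₁ ^ 5 / 3125) + a₁ ^ 3 * (a₂ + 15 * q) / 125 - a₁ ^ 2 * a₃ / 25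
    - a₁ * (3 * a₂ * q - a₄ + 5 * q ^ 2) / 5 + 2 * q * a₃

/-! ### The multisets of Cardano and Ferrari -/

/-- `S` is the multiset of the three numbers
`-ζᵏω(9u₃/2 + 3√Δ/2) - ζ⁻ᵏ(conj ω)(9u₃/2 - 3√Δ/2) + 2u₂²/3`, `k = 0, 1, 2`, where
`Δ = u₃² + 4u₂³/27`, for some choice of a square root `√Δ` (called `d`), of a primitive third root
of unity `ζ` and of a third root `ω` of `(-u₃ + √Δ)/2`. -/
def IsCardanoSet (u₂ u₃ : ℝ) (S : Multiset ℂ) : Prop :=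
  ∃ d ζ ω : ℂ, d ^ 2 = ((u₃ ^ 2 + 4 / 27 * u₂ ^ 3 : ℝ) : ℂ) ∧
    IsPrimitiveRoot ζ 3 ∧
    ω ^ 3 = 1 / 2 * (-(u₃ : ℂ) + d) ∧
    S = (Multiset.range 3).map fun k =>
      -(ζ ^ k * ω * (9 * u₃ / 2 + 3 * d / 2))
        - (ζ⁻¹) ^ k * starRingEnd ℂ ω * (9 * u₃ / 2 - 3 * d / 2) + 2 * u₂ ^ 2 / 3

/-- `X` is the multiset of the four numbers `x_{i₁,i₂}`, `i₁, i₂ ∈ {1, -1}`, for some choice of the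
square and cube roots that occur in their definition. Each root is chosen once: `e` is the root in
the definition of `c`, `s = √(2y)`, and the outer roots depend only on `i₂` (if `u₃ = 0`),
respectively only on `i₁` (if `u₃ ≠ 0`). If `v₂ ≠ 0` then `c ≠ 0`; if `c = 0` then
`v₂ = 0` and the term `v₂ / (3c)` is `0`. -/
def IsFerrariSet (u₂ u₃ u₄ : ℝ) (X : Multiset ℂ) : Prop :=
  (u₃ = 0 ∧
    ∃ (w : ℂ) (t : ℤˣ → ℂ),
      w ^ 2 = ((u₂ ^ 2 - u₄ : ℝ) : ℂ) ∧
      (∀ i₂ : ℤˣ, t i₂ ^ 2 = -(u₂ : ℂ) + ((i₂ : ℤ) : ℂ) * w) ∧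
      X = (Finset.univ : Finset (ℤˣ × ℤˣ)).val.map fun i => ((i.1 : ℤ) : ℂ) * t i.2) ∨
  (u₃ ≠ 0 ∧
    ∃ (v₂ v₃ : ℝ) (e c y s : ℂ) (t : ℤˣ → ℂ),
      v₂ = -(u₂ ^ 2 / 3) - u₄ ∧
      v₃ = 2 * u₂ * u₄ / 3 - 2 * u₂ ^ 3 / 27 - 2 * u₃ ^ 2 ∧
      e ^ 2 = ((v₃ ^ 2 + 4 / 27 * v₂ ^ 3 : ℝ) : ℂ) ∧
      (v₂ = 0 → c ^ 3 = -(v₃ : ℂ)) ∧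
      (v₂ ≠ 0 → c ^ 3 = 1 / 2 * (-(v₃ : ℂ) + e)) ∧
      y = c - v₂ / (3 * c) - 2 * u₂ / 3 ∧
      s ^ 2 = 2 * y ∧
      (∀ i₁ : ℤˣ, t i₁ ^ 2 = -4 * u₂ - 2 * y - ((i₁ : ℤ) : ℂ) * (8 * u₃ / s)) ∧
      X = (Finset.univ : Finset (ℤˣ × ℤˣ)).val.map fun i =>
        (((i.1 : ℤ) : ℂ) * s + ((i.2 : ℤ) : ℂ) * t i.1) / 2)

/-- The elements of the multiset `S`, counted with multiplicity, are the real numbers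
`θ 0 ≤ θ 1 ≤ … ≤ θ (n - 1)`. -/
def IsSortedListing {n : ℕ} (S : Multiset ℂ) (θ : Fin n → ℝ) : Prop :=
  Monotone θ ∧ S = (Finset.univ : Finset (Fin n)).val.map fun k => ((θ k : ℝ) : ℂ)

/-- `H(x) = -x⁵ - (10/3)u₂x³ - 10u₃x² - 5u₄x`. -/
def polyH (u₂ u₃ u₄ x : ℝ) : ℝ :=
  -x ^ 5 - 10 / 3 * u₂ * x ^ 3 - 10 * u₃ * x ^ 2 - 5 * u₄ * x

/-- `Λ₁ = max {H(γ₁), H(γ₃)}` for the sorted `γ₁ ≤ γ₂ ≤ γ₃ ≤ γ₄`, here `γ 0, …, γ 3`. -/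
def Lambda₁ (u₂ u₃ u₄ : ℝ) (γ : Fin 4 → ℝ) : ℝ :=
  max (polyH u₂ u₃ u₄ (γ 0)) (polyH u₂ u₃ u₄ (γ 2))

/-- `Λ₂ = min {H(γ₂), H(γ₄)}`. -/
def Lambda₂ (u₂ u₃ u₄ : ℝ) (γ : Fin 4 → ℝ) : ℝ :=
  min (polyH u₂ u₃ u₄ (γ 1)) (polyH u₂ u₃ u₄ (γ 3))

def CondH (q a₁ a₂ a₃ a₄ a₅ : ℝ) (γ : Fin 4 → ℝ) : Prop :=
  Lambda₁ (u₂ q a₁ a₂) (u₃ q a₁ a₂ a₃) (u₄ q a₁ a₂ a₃ a₄) γ + constA q a₁ a₂ a₃ a₄ ≤ a₅ ∧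
  a₅ ≤ Lambda₂ (u₂ q a₁ a₂) (u₃ q a₁ a₂ a₃) (u₄ q a₁ a₂ a₃ a₄) γ + constA q a₁ a₂ a₃ a₄

/-! ### The two cases with a real root -/

/-- `q = r²` is a square (so `√q = r`) and `h = (x + √q)² h₀` or `h = (x - √q)² h₀` with
`h₀ ∈ W_q(4)`. -/
def CaseI (q : ℕ) (h : ℤ[X]) : Prop :=
  ∃ r : ℕ, q = r ^ 2 ∧ ∃ h₀ ∈ WeilPolys q 4,
    h = (X + C (r : ℤ)) ^ 2 * h₀ ∨ h = (X - C (r : ℤ)) ^ 2 * h₀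

/-- `q` is not a square and `h = (x² - q)² h₀` with `h₀ ∈ W_q(3)`. -/
def CaseII (q : ℕ) (h : ℤ[X]) : Prop :=
  ¬ IsSquare q ∧ ∃ h₀ ∈ WeilPolys q 3, h = (X ^ 2 - C (q : ℤ)) ^ 2 * h₀

end

/-!
Since `|w|² = q`, each pair of roots `w, conj w` contributes a real quadratic `x² - tx + q` with
`t = 2 Re w ∈ [-2√q, 2√q]`, so `h(x) = x⁵ f(x + q/x)` is a Weil polynomial exactly when the real
quintic `f` has all its roots in `[-2√q, 2√q]` (`weilShape_mem_iff`). After the shift by `a₁/5` the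
polynomial `f` becomes the depressed quintic `x⁵ + (10/3)u₂x³ + 10u₃x² + 5u₄x + (a₅ - A)` on the
interval with end points `a₁/5 ± 2√q`, and its derivatives are, up to constant factors, the
polynomials `x⁴ + 2u₂x² + 4u₃x + u₄`, `x³ + u₂x + u₃`, `x² + u₂/3` and `x`.

The central fact, `exists_hasRootsIn_iff`, climbs this chain one step at a time: if the derivative of
a monic polynomial `P` has all its roots in `[lo, hi]`, then so does `P` if and only if the signs of
`P` at `lo`, at the sorted critical points and at `hi` alternate weakly. One direction is Rolle's
theorem, the other the intermediate value theorem; in both, repeated roots are handled by comparing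
multiplicities with those of the interlacing sequence. The inequalities (a), (b*), (d), (f), (g) are
the sign conditions at the end points; (b), (c), (e), (h) are those at the critical points of the
quadratic, cubic, quartic and quintic. For the last two the critical points come from Cardano's and
Ferrari's formulas: the elements of `S` are the constant terms for which the quartic vanishes at
one of its critical points (`IsCardanoSet.eq_map_critValue`), and the elements of `X` are the roots
of the quartic (`IsFerrariSet.prod_eq`).

A real root of a Weil polynomial is `±√q` and corresponds to an end point root of the quintic. If a
derivative vanishes at an end point then so does the quintic, because the roots interlace inside the
interval; hence an equality in any end point condition gives a real root (`someEquality_iff`). A real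
root is a double root; if `√q` is irrational, then its conjugate is a double root as well, which
gives the two factorizations (`mem_and_hasRealRoot_iff`).
-/

/-! ### Interlacing real roots -/

/-- The numbers `σ 0, …, σ (n - 1)` interlace `r 0, …, r n`: `r i ≤ σ i ≤ r (i + 1)`. -/
def Interlaces {n : ℕ} (r : Fin (n + 1) → ℝ) (σ : Fin n → ℝ) : Prop :=
  ∀ i : Fin n, r i.castSucc ≤ σ i ∧ σ i ≤ r i.succ

/-- `P` is monic of degree `n`, all its roots are real and lie in `[lo, hi]`, and `r` lists them
with multiplicity in increasing order. -/
structure HasRootsIn (lo hi : ℝ) {n : ℕ} (P : ℝ[X]) (r : Fin n → ℝ) : Prop where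
  mono : Monotone r
  mem : ∀ i, lo ≤ r i ∧ r i ≤ hi
  eq_prod : P = ∏ i, (X - C (r i))

lemma Interlaces.monotone_left {n : ℕ} {r : Fin (n + 1) → ℝ} {σ : Fin n → ℝ}
    (h : Interlaces r σ) : Monotone r :=
  Fin.monotone_iff_le_succ.2 fun i => (h i).1.trans (h i).2

lemma Interlaces.monotone_right {n : ℕ} {r : Fin (n + 1) → ℝ} {σ : Fin n → ℝ}
    (h : Interlaces r σ) : Monotone σ := by
  intro i j hij
  rcases hij.eq_or_lt with rfl | hlt
  · exact le_rfl
  · exact (h i).2.trans ((h.monotone_left (Fin.succ_le_castSucc_iff.2 hlt)).trans (h j).1)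

lemma roots_prod_X_sub_C_fin {n : ℕ} (r : Fin n → ℝ) :
    (∏ i, (X - C (r i))).roots = (Finset.univ : Finset (Fin n)).val.map r := by
  have := roots_multiset_prod_X_sub_C ((Finset.univ : Finset (Fin n)).val.map r)
  rwa [Multiset.map_map] at this

lemma monic_prod_X_sub_C_fin {n : ℕ} (r : Fin n → ℝ) : (∏ i, (X - C (r i))).Monic :=
  monic_prod_of_monic _ _ fun _ _ => monic_X_sub_C _

/-- A monotone listing of a multiset is unique. -/
lemma eq_of_monotone_of_map_eq {n : ℕ} {r s : Fin n → ℝ} (hr : Monotone r) (hs : Monotone s)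
    (h : (Finset.univ : Finset (Fin n)).val.map r = (Finset.univ : Finset (Fin n)).val.map s) :
    r = s := by
  have hp : (List.ofFn r).Perm (List.ofFn s) := by
    rw [← Multiset.coe_eq_coe]
    simpa [Fin.univ_val_map] using h
  exact List.ofFn_injective (hp.eq_of_sortedLE hr.sortedLE_ofFn hs.sortedLE_ofFn)

lemma HasRootsIn.unique {lo hi lo' hi' : ℝ} {n : ℕ} {P : ℝ[X]} {r s : Fin n → ℝ}
    (hr : HasRootsIn lo hi P r) (hs : HasRootsIn lo' hi' P s) : r = s := by
  refine eq_of_monotone_of_map_eq hr.mono hs.mono ?_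
  rw [← roots_prod_X_sub_C_fin, ← roots_prod_X_sub_C_fin, ← hr.eq_prod, ← hs.eq_prod]

lemma count_map_univ {n : ℕ} (r : Fin n → ℝ) (ρ : ℝ) :
    ((Finset.univ : Finset (Fin n)).val.map r).count ρ
      = (Finset.univ.filter fun i => ρ = r i).card := by
  rw [Multiset.count_map]; rfl

/-- In interlacing sequences a value occurs at most once more in the longer one. -/
lemma Interlaces.card_le {n : ℕ} {r : Fin (n + 1) → ℝ} {σ : Fin n → ℝ} (h : Interlaces r σ)
    (ρ : ℝ) : (Finset.univ.filter fun i => ρ = r i).card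
      ≤ (Finset.univ.filter fun i => ρ = σ i).card + 1 := by
  rcases (Finset.univ.filter fun i => ρ = r i).eq_empty_or_nonempty with he | hne
  · simp [he]
  set i₀ := (Finset.univ.filter fun i => ρ = r i).min' hne
  have hi₀ : ρ = r i₀ := (Finset.mem_filter.1 (Finset.min'_mem _ hne)).2
  have hsub : (Finset.univ.filter fun i => ρ = r i)
      ⊆ insert i₀ ((Finset.univ.filter fun i => ρ = σ i).image Fin.succ) := by
    intro i hi
    have hi' := (Finset.mem_filter.1 hi).2
    rcases (Finset.min'_le _ i hi).eq_or_lt with he | hlt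
    · rw [← he]; exact Finset.mem_insert_self _ _
    · refine Finset.mem_insert_of_mem (Finset.mem_image.2 ?_)
      obtain ⟨j, rfl⟩ := Fin.exists_succ_eq.2 (ne_bot_of_gt hlt)
      refine ⟨j, Finset.mem_filter.2 ⟨Finset.mem_univ _, le_antisymm ?_ ?_⟩, rfl⟩
      · exact hi₀.le.trans ((h.monotone_left (Fin.le_castSucc_iff.2 hlt)).trans (h j).1)
      · exact (h j).2.trans hi'.ge
  refine (Finset.card_le_card hsub).trans ((Finset.card_insert_le _ _).trans ?_)
  exact Nat.add_le_add_right Finset.card_image_le 1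

/-- If `P` vanishes on a sequence interlaced by the roots of its derivative, then this sequence
lists all the roots of `P`: a value occurring `k` times in it occurs at least `k - 1` times among
the roots of the derivative. -/
lemma eq_prod_of_interlaces {n : ℕ} {P : ℝ[X]} (hP : P.Monic) (hdeg : P.natDegree = n + 1)
    {r : Fin (n + 1) → ℝ} {σ : Fin n → ℝ} (h : Interlaces r σ) (hr : ∀ i, P.eval (r i) = 0)
    (hder : derivative P = C (n + 1 : ℝ) * ∏ i, (X - C (σ i))) :
    P = ∏ i, (X - C (r i)) := by
  have hn : (n + 1 : ℝ) ≠ 0 := by positivity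
  have hle : (Finset.univ : Finset (Fin (n + 1))).val.map r ≤ P.roots := by
    rw [Multiset.le_iff_count]
    intro ρ
    rw [count_map_univ, count_roots]
    by_cases hρ : P.IsRoot ρ
    · have h1 := derivative_rootMultiplicity_of_root hρ
      rw [← count_roots, hder, roots_C_mul _ hn, roots_prod_X_sub_C_fin, count_map_univ] at h1
      have h2 := h.card_le ρ
      have h3 := (rootMultiplicity_pos hP.ne_zero).2 hρ
      omega
    · rw [Finset.card_eq_zero.2]
      · exact Nat.zero_le _
      · refine Finset.filter_eq_empty_iff.2 fun i _ hi => hρ ?_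
        rw [hi]; exact hr i
  have heq := Multiset.eq_of_le_of_card_le hle (by simpa [hdeg] using P.card_roots')
  have := prod_multiset_X_sub_C_of_monic_of_roots_card_eq hP (by rw [← heq]; simp [hdeg])
  rw [← this, ← heq, Multiset.map_map]
  rfl

/-- A monic polynomial of degree `n + 1` that changes sign weakly between consecutive points of
`lo, σ 0, …, σ (n - 1), hi`, where the `σ i` are the critical points, has all its roots real and in
`[lo, hi]`. -/
lemma exists_hasRootsIn_of_signs {n : ℕ} {P : ℝ[X]} (hP : P.Monic) (hdeg : P.natDegree = n + 1)
    {s : Fin (n + 2) → ℝ} (hs : Monotone s)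
    (hder : derivative P = C (n + 1 : ℝ) * ∏ i : Fin n, (X - C (s i.succ.castSucc)))
    (hsign : ∀ j : Fin (n + 2), 0 ≤ (-1) ^ (n + 1 - (j : ℕ)) * P.eval (s j)) :
    ∃ r : Fin (n + 1) → ℝ, HasRootsIn (s 0) (s (Fin.last _)) P r := by
  have hex : ∀ i : Fin (n + 1), ∃ x, (s i.castSucc ≤ x ∧ x ≤ s i.succ) ∧ P.eval x = 0 := by
    intro i
    have h1 := hsign i.castSucc
    have h2 := hsign i.succ
    have hi : s i.castSucc ≤ s i.succ := hs i.castSucc_le_succ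
    have hcont : ContinuousOn (fun x => P.eval x) (Set.Icc (s i.castSucc) (s i.succ)) :=
      P.continuous.continuousOn
    have he : n + 1 - (i.castSucc : ℕ) = (n + 1 - (i.succ : ℕ)) + 1 := by
      have := i.2
      simp only [Fin.val_castSucc, Fin.val_succ]
      omega
    rw [he, pow_succ] at h1
    rcases neg_one_pow_eq_or ℝ (n + 1 - (i.succ : ℕ)) with hp | hp <;> rw [hp] at h1 h2
    · obtain ⟨x, hx, hx0⟩ := intermediate_value_Icc hi hcont
        (show (0 : ℝ) ∈ Set.Icc _ _ from ⟨by linarith, by linarith⟩)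
      exact ⟨x, hx, hx0⟩
    · obtain ⟨x, hx, hx0⟩ := intermediate_value_Icc' hi hcont
        (show (0 : ℝ) ∈ Set.Icc _ _ from ⟨by linarith, by linarith⟩)
      exact ⟨x, hx, hx0⟩
  choose r hr hr0 using hex
  have hint : Interlaces r fun i => s i.succ.castSucc := fun i =>
    ⟨by have := (hr i.castSucc).2; rwa [Fin.succ_castSucc] at this, (hr i.succ).1⟩
  exact ⟨r, hint.monotone_left,
    fun i => ⟨(hs (Fin.zero_le _)).trans (hr i).1, (hr i).2.trans (hs (Fin.le_last _))⟩,
    eq_prod_of_interlaces hP hdeg hint hr0 hder⟩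

lemma eval_eq_zero_of_eq_prod {n : ℕ} {P : ℝ[X]} {r : Fin n → ℝ} (h : P = ∏ i, (X - C (r i)))
    (i : Fin n) : P.eval (r i) = 0 := by
  rw [h, eval_prod]
  exact Finset.prod_eq_zero (Finset.mem_univ i) (by simp)

lemma exists_eq_of_eval_eq_zero {n : ℕ} {P : ℝ[X]} {r : Fin n → ℝ}
    (h : P = ∏ i, (X - C (r i))) {x : ℝ} (hx : P.eval x = 0) : ∃ i, x = r i := by
  rw [h, eval_prod, Finset.prod_eq_zero_iff] at hx
  obtain ⟨i, -, hi⟩ := hx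
  exact ⟨i, by simpa [sub_eq_zero] using hi⟩

/-- Rolle's theorem with multiplicities: the critical points interlace the roots. -/
lemma exists_interlaces_derivative {n : ℕ} {P Q : ℝ[X]} (hQ : Q.Monic) (hdeg : Q.natDegree = n)
    (hder : derivative P = C (n + 1 : ℝ) * Q) {r : Fin (n + 1) → ℝ} (hr : Monotone r)
    (hP : P = ∏ i, (X - C (r i))) :
    ∃ σ : Fin n → ℝ, Interlaces r σ ∧ Q = ∏ i, (X - C (σ i)) := by
  have hn : (n + 1 : ℝ) ≠ 0 := by positivity
  have hP0 : P ≠ 0 := by rw [hP]; exact (monic_prod_X_sub_C_fin r).ne_zero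
  -- At a double root take that root; otherwise take a point strictly inside.
  have hex : ∀ i : Fin n, ∃ x, r i.castSucc ≤ x ∧ x ≤ r i.succ ∧ Q.eval x = 0 ∧
      (P.eval x = 0 → x = r i.castSucc ∧ x = r i.succ) := by
    intro i
    rcases (hr i.castSucc_le_succ).eq_or_lt with he | hlt
    · refine ⟨r i.succ, he.le, le_rfl, ?_, fun _ => ⟨he.symm, rfl⟩⟩
      have hroot : P.IsRoot (r i.succ) := eval_eq_zero_of_eq_prod hP _
      have h2 : 1 < P.rootMultiplicity (r i.succ) := by
        rw [← count_roots, hP, roots_prod_X_sub_C_fin, count_map_univ, Finset.one_lt_card]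
        exact ⟨i.castSucc, by simp [he], i.succ, by simp, (Fin.castSucc_lt_succ (i := i)).ne⟩
      have h3 := derivative_rootMultiplicity_of_root hroot
      have h4 : 0 < (derivative P).rootMultiplicity (r i.succ) := by omega
      have h5 := (rootMultiplicity_pos'.1 h4).2
      rw [hder, IsRoot, eval_mul, eval_C] at h5
      exact (mul_eq_zero.1 h5).resolve_left hn
    · obtain ⟨c, hc, hc0⟩ := exists_hasDerivAt_eq_zero (f := fun x => P.eval x) hlt
        P.continuous.continuousOn
        (by simp only [eval_eq_zero_of_eq_prod hP]) (fun x _ => P.hasDerivAt x)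
      rw [hder, eval_mul, eval_C] at hc0
      refine ⟨c, hc.1.le, hc.2.le, (mul_eq_zero.1 hc0).resolve_left hn, fun h0 => ?_⟩
      obtain ⟨j, rfl⟩ := exists_eq_of_eval_eq_zero hP h0
      rcases le_or_gt j i.castSucc with hj | hj
      · exact absurd hc.1 (hr hj).not_gt
      · exact absurd hc.2 (hr (Fin.castSucc_lt_iff_succ_le.1 hj)).not_gt
  choose σ h1 h2 h3 h4 using hex
  have hint : Interlaces r σ := fun i => ⟨h1 i, h2 i⟩
  refine ⟨σ, hint, ?_⟩
  have hQr : Q.roots = (derivative P).roots := by rw [hder, roots_C_mul _ hn]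
  have hle : (Finset.univ : Finset (Fin n)).val.map σ ≤ Q.roots := by
    rw [Multiset.le_iff_count]
    intro ρ
    rw [count_map_univ]
    by_cases hρ : P.IsRoot ρ
    · rw [hQr, count_roots, derivative_rootMultiplicity_of_root hρ, ← count_roots P]
      have hroots : P.roots = (Finset.univ : Finset (Fin (n + 1))).val.map r := by
        rw [hP, roots_prod_X_sub_C_fin]
      rw [hroots, count_map_univ]
      have hne : (Finset.univ.filter fun i => ρ = r i).Nonempty := by
        obtain ⟨i, hi⟩ := exists_eq_of_eval_eq_zero hP hρ
        exact ⟨i, by simp [hi]⟩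
      -- The least index with root `ρ` is not a successor of an index with critical point `ρ`.
      rw [← Finset.card_erase_of_mem (Finset.min'_mem _ hne),
        ← Finset.card_image_of_injective _ (Fin.succ_injective n)]
      refine Finset.card_le_card fun k hk => ?_
      obtain ⟨j, hj, rfl⟩ := Finset.mem_image.1 hk
      have hj' := (Finset.mem_filter.1 hj).2
      have h5 := h4 j (by rw [← hj']; exact hρ)
      rw [← hj'] at h5
      refine Finset.mem_erase.2 ⟨fun he => ?_, by simp [h5.2.symm]⟩
      have := Finset.min'_le (Finset.univ.filter fun i => ρ = r i) j.castSucc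
        (by simp [h5.1.symm])
      rw [← he] at this
      exact absurd this (Fin.castSucc_lt_succ (i := j)).not_ge
    · by_cases hne : (Finset.univ.filter fun i => ρ = σ i).Nonempty
      · obtain ⟨i, hi⟩ := hne
        have hi' := (Finset.mem_filter.1 hi).2
        have hle1 : (Finset.univ.filter fun i => ρ = σ i).card ≤ 1 := by
          rw [Finset.card_le_one]
          have key : ∀ a b : Fin n, ρ = σ a → ρ = σ b → ¬ a < b := by
            intro a b ha hb hab
            have e : ρ = r a.succ := le_antisymm (ha.le.trans (h2 a))
              ((hr (Fin.succ_le_castSucc_iff.2 hab)).trans ((h1 b).trans hb.ge))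
            exact hρ (by rw [e]; exact eval_eq_zero_of_eq_prod hP _)
          intro a ha b hb
          have ha' := (Finset.mem_filter.1 ha).2
          have hb' := (Finset.mem_filter.1 hb).2
          exact le_antisymm (not_lt.1 (key b a hb' ha')) (not_lt.1 (key a b ha' hb'))
        refine hle1.trans (Multiset.one_le_count_iff_mem.2 ((mem_roots hQ.ne_zero).2 ?_))
        rw [hi']; exact h3 i
      · rw [Finset.not_nonempty_iff_eq_empty.1 hne]; simp
  have heq := Multiset.eq_of_le_of_card_le hle (by simpa [hdeg] using Q.card_roots')
  have := prod_multiset_X_sub_C_of_monic_of_roots_card_eq hQ (by rw [← heq]; simp [hdeg])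
  rw [← this, ← heq, Multiset.map_map]
  rfl

lemma HasRootsIn.exists_derivative {lo hi : ℝ} {n : ℕ} {P Q : ℝ[X]} (hQ : Q.Monic)
    (hdeg : Q.natDegree = n) (hder : derivative P = C (n + 1 : ℝ) * Q) {r : Fin (n + 1) → ℝ}
    (h : HasRootsIn lo hi P r) : ∃ σ : Fin n → ℝ, HasRootsIn lo hi Q σ ∧ Interlaces r σ := by
  obtain ⟨σ, hint, hprod⟩ := exists_interlaces_derivative hQ hdeg hder h.mono h.eq_prod
  exact ⟨σ, ⟨hint.monotone_right, fun i => ⟨(h.mem _).1.trans (hint i).1,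
    (hint i).2.trans (h.mem _).2⟩, hprod⟩, hint⟩

/-- A polynomial with sorted roots `r` has at a point between consecutive roots the sign given by
the number of larger roots. -/
lemma sign_eval_of_between {n : ℕ} {P : ℝ[X]} {r : Fin (n + 1) → ℝ} (hr : Monotone r)
    (hP : P = ∏ i, (X - C (r i))) (i : Fin n) {x : ℝ} (h1 : r i.castSucc ≤ x)
    (h2 : x ≤ r i.succ) : 0 ≤ (-1) ^ (n - (i : ℕ)) * P.eval x := by
  have hcard : (-1 : ℝ) ^ (n - (i : ℕ)) = ∏ j : Fin (n + 1), if i.castSucc < j then -1 else 1 := by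
    rw [Finset.prod_ite, Finset.prod_const, Finset.prod_const, one_pow, mul_one]
    congr 1
    have := Fin.card_Ioi i.castSucc
    rw [← Finset.filter_lt_eq_Ioi] at this
    rw [this]; simp
  rw [hcard, hP, eval_prod, ← Finset.prod_mul_distrib]
  refine Finset.prod_nonneg fun j _ => ?_
  simp only [eval_sub, eval_X, eval_C]
  split_ifs with hj
  · have := hr (Fin.castSucc_lt_iff_succ_le.1 hj); linarith
  · have := hr (not_lt.1 hj); linarith

lemma HasRootsIn.eval_hi_nonneg {lo hi : ℝ} {n : ℕ} {P : ℝ[X]} {r : Fin n → ℝ}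
    (h : HasRootsIn lo hi P r) : 0 ≤ P.eval hi := by
  rw [h.eq_prod, eval_prod]
  exact Finset.prod_nonneg fun i _ => by simpa using (h.mem i).2

lemma HasRootsIn.eval_lo_sign {lo hi : ℝ} {n : ℕ} {P : ℝ[X]} {r : Fin n → ℝ}
    (h : HasRootsIn lo hi P r) : 0 ≤ (-1) ^ n * P.eval lo := by
  have : (-1 : ℝ) ^ n = ∏ _i : Fin n, (-1) := by simp
  rw [this, h.eq_prod, eval_prod, ← Finset.prod_mul_distrib]
  exact Finset.prod_nonneg fun i _ => by simpa using (h.mem i).1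

/-- Given the sorted roots `σ` in `[lo, hi]` of the derivative, all roots of `P` are real and lie
in `[lo, hi]` if and only if the signs of `P` at `lo`, `σ`, `hi` alternate. -/
theorem exists_hasRootsIn_iff {lo hi : ℝ} (hlh : lo ≤ hi) {n : ℕ} {P Q : ℝ[X]} (hP : P.Monic)
    (hPdeg : P.natDegree = n + 1) (hder : derivative P = C (n + 1 : ℝ) * Q) {σ : Fin n → ℝ}
    (hσ : HasRootsIn lo hi Q σ) :
    (∃ r : Fin (n + 1) → ℝ, HasRootsIn lo hi P r) ↔
      0 ≤ (-1) ^ (n + 1) * P.eval lo ∧ 0 ≤ P.eval hi ∧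
        ∀ i : Fin n, 0 ≤ (-1) ^ (n - (i : ℕ)) * P.eval (σ i) := by
  have hQ : Q.Monic := by rw [hσ.eq_prod]; exact monic_prod_X_sub_C_fin σ
  have hQdeg : Q.natDegree = n := by
    rw [hσ.eq_prod, natDegree_prod_of_monic _ _ fun _ _ => monic_X_sub_C _]; simp
  constructor
  · rintro ⟨r, hr⟩
    obtain ⟨σ', hσ', hint⟩ := hr.exists_derivative hQ hQdeg hder
    obtain rfl := hσ.unique hσ'
    exact ⟨hr.eval_lo_sign, hr.eval_hi_nonneg,
      fun i => sign_eval_of_between hr.mono hr.eq_prod i (hint i).1 (hint i).2⟩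
  · rintro ⟨h1, h2, h3⟩
    let s : Fin (n + 2) → ℝ := Fin.cons lo (Fin.snoc σ hi)
    have hs0 : s 0 = lo := rfl
    have hs1 : s (Fin.last _) = hi := by
      change s (Fin.last n).succ = hi
      simp [s]
    have hsm : ∀ i : Fin n, s i.succ.castSucc = σ i := by
      intro i
      rw [← Fin.succ_castSucc]
      simp [s]
    have hmono : Monotone s := by
      refine Fin.monotone_iff_le_succ.2 fun i => ?_
      cases i using Fin.cases with
      | zero =>
        change lo ≤ s (Fin.succ 0)
        simp only [s, Fin.cons_succ]
        cases n with
        | zero => simpa [Fin.snoc] using hlh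
        | succ m =>
          have : (0 : Fin (m + 2)) = (0 : Fin (m + 1)).castSucc := rfl
          rw [this, Fin.snoc_castSucc]
          exact (hσ.mem 0).1
      | succ i =>
        rw [hsm]
        change σ i ≤ (Fin.snoc σ hi : Fin (n + 1) → ℝ) i.succ
        cases n with
        | zero => exact i.elim0
        | succ m =>
          cases i using Fin.lastCases with
          | last =>
            rw [Fin.succ_last, Fin.snoc_last]
            exact (hσ.mem _).2
          | cast i =>
            rw [Fin.succ_castSucc, Fin.snoc_castSucc]
            exact hσ.mono i.castSucc_le_succ
    obtain ⟨r, hr⟩ := exists_hasRootsIn_of_signs hP hPdeg hmono (by simp only [hsm, hder, ← hσ.eq_prod])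
      (by
        intro j
        cases j using Fin.cases with
        | zero => simpa [hs0] using h1
        | succ j =>
          cases j using Fin.lastCases with
          | last => simpa [hs1] using h2
          | cast j =>
            have := h3 j
            rw [← hsm j, ← Fin.succ_castSucc] at this
            simpa using this)
    rw [hs0, hs1] at hr
    exact ⟨r, hr⟩

/-- If the largest critical point is the right end point, so is the largest root. -/
lemma HasRootsIn.eval_hi_eq_zero {lo hi : ℝ} {n : ℕ} {P Q : ℝ[X]} (hQ : Q.Monic)
    (hdeg : Q.natDegree = n) (hder : derivative P = C (n + 1 : ℝ) * Q) {r : Fin (n + 1) → ℝ}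
    (h : HasRootsIn lo hi P r) (h0 : Q.eval hi = 0) : P.eval hi = 0 := by
  obtain ⟨σ, hσ, hint⟩ := h.exists_derivative hQ hdeg hder
  obtain ⟨i, hi'⟩ := exists_eq_of_eval_eq_zero hσ.eq_prod h0
  have : hi = r i.succ := le_antisymm (hi'.le.trans (hint i).2) (h.mem _).2
  rw [this]; exact eval_eq_zero_of_eq_prod h.eq_prod _

lemma HasRootsIn.eval_lo_eq_zero {lo hi : ℝ} {n : ℕ} {P Q : ℝ[X]} (hQ : Q.Monic)
    (hdeg : Q.natDegree = n) (hder : derivative P = C (n + 1 : ℝ) * Q) {r : Fin (n + 1) → ℝ}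
    (h : HasRootsIn lo hi P r) (h0 : Q.eval lo = 0) : P.eval lo = 0 := by
  obtain ⟨σ, hσ, hint⟩ := h.exists_derivative hQ hdeg hder
  obtain ⟨i, hi'⟩ := exists_eq_of_eval_eq_zero hσ.eq_prod h0
  have : lo = r i.castSucc := le_antisymm (h.mem _).1 ((hint i).1.trans hi'.ge)
  rw [this]; exact eval_eq_zero_of_eq_prod h.eq_prod _

/-! ### The depressed quintic and its normalized derivatives -/

/-- The depressed quadratic `x² + u₂/3`. In this chain `p`, `s`, `t` stand for `u₂`, `u₃`, `u₄`, and
each polynomial is the derivative of the next one, made monic. -/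
noncomputable def depQuadratic (p : ℝ) : ℝ[X] := X ^ 2 + C (p / 3)

/-- The depressed cubic `x³ + u₂x + u₃`. -/
noncomputable def depCubic (p s : ℝ) : ℝ[X] := X ^ 3 + C p * X + C s

/-- The depressed quartic `x⁴ + 2u₂x² + 4u₃x + u₄`. -/
noncomputable def depQuartic (p s t : ℝ) : ℝ[X] := X ^ 4 + C (2 * p) * X ^ 2 + C (4 * s) * X + C t

/-- The depressed quintic `x⁵ + (10/3)u₂x³ + 10u₃x² + 5u₄x + k`. -/
noncomputable def depQuintic (p s t k : ℝ) : ℝ[X] :=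
  X ^ 5 + C (10 / 3 * p) * X ^ 3 + C (10 * s) * X ^ 2 + C (5 * t) * X + C k

section Chain

variable (p s t k : ℝ)

lemma depQuadratic_monic : (depQuadratic p).Monic := by unfold depQuadratic; monicity!
lemma depCubic_monic : (depCubic p s).Monic := by unfold depCubic; monicity!
lemma depQuartic_monic : (depQuartic p s t).Monic := by unfold depQuartic; monicity!
lemma depQuintic_monic : (depQuintic p s t k).Monic := by unfold depQuintic; monicity!

lemma natDegree_depQuadratic : (depQuadratic p).natDegree = 2 := by
  unfold depQuadratic; compute_degree!
lemma natDegree_depCubic : (depCubic p s).natDegree = 3 := by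
  unfold depCubic; compute_degree!
lemma natDegree_depQuartic : (depQuartic p s t).natDegree = 4 := by
  unfold depQuartic; compute_degree!
lemma natDegree_depQuintic : (depQuintic p s t k).natDegree = 5 := by
  unfold depQuintic; compute_degree!

lemma derivative_depQuadratic : derivative (depQuadratic p) = C ((1 : ℕ) + 1 : ℝ) * X := by
  refine Polynomial.funext fun x => ?_
  simp [depQuadratic]

lemma derivative_depCubic :
    derivative (depCubic p s) = C ((2 : ℕ) + 1 : ℝ) * depQuadratic p := by
  refine Polynomial.funext fun x => ?_
  simp [depCubic, depQuadratic]; ring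

lemma derivative_depQuartic :
    derivative (depQuartic p s t) = C ((3 : ℕ) + 1 : ℝ) * depCubic p s := by
  refine Polynomial.funext fun x => ?_
  simp [depQuartic, depCubic]; ring

lemma derivative_depQuintic :
    derivative (depQuintic p s t k) = C ((4 : ℕ) + 1 : ℝ) * depQuartic p s t := by
  refine Polynomial.funext fun x => ?_
  simp [depQuintic, depQuartic]; ring

variable {p s t k} {lo hi : ℝ}

lemma exists_hasRootsIn_X_iff :
    (∃ r : Fin 1 → ℝ, HasRootsIn lo hi X r) ↔ lo ≤ 0 ∧ 0 ≤ hi := by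
  constructor
  · rintro ⟨r, hr⟩
    have h0 : r 0 = 0 := by
      have := congrArg (eval 0) hr.eq_prod
      simpa using this
    simpa [h0] using hr.mem 0
  · rintro h
    exact ⟨fun _ => 0, fun _ _ _ => le_rfl, fun _ => h, by simp⟩

lemma exists_hasRootsIn_depQuadratic_iff (hlh : lo ≤ hi) :
    (∃ r : Fin 2 → ℝ, HasRootsIn lo hi (depQuadratic p) r) ↔
      (lo ≤ 0 ∧ 0 ≤ hi) ∧ (0 ≤ lo ^ 2 + p / 3 ∧ 0 ≤ hi ^ 2 + p / 3) ∧ p ≤ 0 := by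
  rw [← exists_hasRootsIn_X_iff]
  constructor
  · rintro ⟨r, hr⟩
    obtain ⟨σ, hσ, -⟩ := hr.exists_derivative monic_X natDegree_X (derivative_depQuadratic p)
    have h0 : σ 0 = 0 := by
      have := congrArg (eval 0) hσ.eq_prod
      simpa using this
    have := (exists_hasRootsIn_iff hlh (depQuadratic_monic p) (natDegree_depQuadratic p)
      (derivative_depQuadratic p) hσ).1 ⟨r, hr⟩
    simp [depQuadratic, h0] at this
    exact ⟨⟨σ, hσ⟩, ⟨this.1, this.2.1⟩, by linarith⟩
  · rintro ⟨⟨σ, hσ⟩, ⟨h1, h2⟩, h3⟩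
    have h0 : σ 0 = 0 := by
      have := congrArg (eval 0) hσ.eq_prod
      simpa using this
    refine (exists_hasRootsIn_iff hlh (depQuadratic_monic p) (natDegree_depQuadratic p)
      (derivative_depQuadratic p) hσ).2 ?_
    simp [depQuadratic, h0]
    exact ⟨h1, h2, by linarith⟩

lemma HasRootsIn.depQuadratic_eq {σ : Fin 2 → ℝ} (h : HasRootsIn lo hi (depQuadratic p) σ) :
    σ = ![-√(-p / 3), √(-p / 3)] := by
  have h0 := congrArg (eval 0) h.eq_prod
  have h1 := congrArg (eval 1) h.eq_prod
  have hm := h.mono (show (0 : Fin 2) ≤ 1 by decide)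
  simp [depQuadratic, Fin.prod_univ_two] at h0 h1
  have hs : σ 0 = - σ 1 := by linarith
  have h2 : √(-p / 3) = σ 1 := by
    rw [show -p / 3 = σ 1 ^ 2 by rw [hs] at h0; linarith]
    exact Real.sqrt_sq (by linarith)
  ext i
  fin_cases i
  · simp [h2, hs]
  · simp [h2]

lemma exists_hasRootsIn_depCubic_iff (hlh : lo ≤ hi) :
    (∃ r : Fin 3 → ℝ, HasRootsIn lo hi (depCubic p s) r) ↔
      ((lo ≤ 0 ∧ 0 ≤ hi) ∧ (0 ≤ lo ^ 2 + p / 3 ∧ 0 ≤ hi ^ 2 + p / 3) ∧ p ≤ 0) ∧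
      ((depCubic p s).eval lo ≤ 0 ∧ 0 ≤ (depCubic p s).eval hi) ∧
        |s| ≤ 2 * √(-p / 3) ^ 3 := by
  rw [← exists_hasRootsIn_depQuadratic_iff hlh]
  have key : ∀ σ : Fin 2 → ℝ, HasRootsIn lo hi (depQuadratic p) σ →
      ((∃ r : Fin 3 → ℝ, HasRootsIn lo hi (depCubic p s) r) ↔
        ((depCubic p s).eval lo ≤ 0 ∧ 0 ≤ (depCubic p s).eval hi) ∧
        |s| ≤ 2 * √(-p / 3) ^ 3) := by
    intro σ hσ
    have hp : p ≤ 0 := ((exists_hasRootsIn_depQuadratic_iff hlh).1 ⟨σ, hσ⟩).2.2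
    rw [exists_hasRootsIn_iff hlh (depCubic_monic p s) (natDegree_depCubic p s)
      (derivative_depCubic p s) hσ, hσ.depQuadratic_eq, abs_le]
    have hz : √(-p / 3) ^ 2 = -p / 3 := Real.sq_sqrt (by linarith)
    set z := √(-p / 3)
    have hp' : p = -3 * z ^ 2 := by rw [hz]; ring
    have e0 : (depCubic p s).eval (-z) = s + 2 * z ^ 3 := by
      simp [depCubic]; rw [hp']; ring
    have e1 : (depCubic p s).eval z = s - 2 * z ^ 3 := by
      simp [depCubic]; rw [hp']; ring
    simp only [Fin.forall_fin_two, Matrix.cons_val_zero, Matrix.cons_val_one, e0, e1]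
    norm_num
    constructor
    · rintro ⟨h1, h2, h3, h4⟩
      exact ⟨⟨by linarith, h2⟩, by linarith, by linarith⟩
    · rintro ⟨⟨h1, h2⟩, h3, h4⟩
      exact ⟨by linarith, h2, by linarith, by linarith⟩
  constructor
  · rintro ⟨r, hr⟩
    obtain ⟨σ, hσ, -⟩ := hr.exists_derivative (depQuadratic_monic p) (natDegree_depQuadratic p)
      (derivative_depCubic p s)
    exact ⟨⟨σ, hσ⟩, (key σ hσ).1 ⟨r, hr⟩⟩
  · rintro ⟨⟨σ, hσ⟩, h⟩
    exact (key σ hσ).2 h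

/-- The value of `-(x⁴ + 2u₂x² + 4u₃x)`; at a root `x` of the cubic this is the constant term for
which the quartic has a multiple root at `x`. -/
noncomputable def critValue (p s x : ℝ) : ℝ := -(x ^ 4 + 2 * p * x ^ 2 + 4 * s * x)

lemma eval_depQuartic (x : ℝ) : (depQuartic p s t).eval x = t - critValue p s x := by
  simp [depQuartic, critValue]; ring

lemma HasRootsIn.depCubic_coeffs {τ : Fin 3 → ℝ} (h : HasRootsIn lo hi (depCubic p s) τ) :
    τ 2 = -τ 0 - τ 1 ∧ p = τ 0 * τ 1 + τ 0 * τ 2 + τ 1 * τ 2 ∧ s = -(τ 0 * τ 1 * τ 2) := by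
  have h0 := congrArg (eval 0) h.eq_prod
  have h1 := congrArg (eval 1) h.eq_prod
  have h2 := congrArg (eval (-1)) h.eq_prod
  simp [depCubic, Fin.prod_univ_three] at h0 h1 h2
  refine ⟨by linarith, by linarith, by linarith⟩

lemma HasRootsIn.critValue_le {τ : Fin 3 → ℝ} (h : HasRootsIn lo hi (depCubic p s) τ) :
    critValue p s (τ 1) ≤ critValue p s (τ 0) ∧ critValue p s (τ 1) ≤ critValue p s (τ 2) := by
  obtain ⟨h2, hp, hs⟩ := h.depCubic_coeffs
  have m1 : 0 ≤ τ 1 - τ 0 := sub_nonneg.2 (h.mono (by decide))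
  have m2 : 0 ≤ τ 2 - τ 1 := sub_nonneg.2 (h.mono (by decide))
  -- The integral of `4(x - τ₀)(x - τ₁)(x - τ₂)` over an interval between consecutive roots.
  constructor
  · have : critValue p s (τ 0) - critValue p s (τ 1)
        = (τ 1 - τ 0) ^ 3 * (2 * (τ 2 - τ 1) + (τ 1 - τ 0)) / 3 := by
      rw [hp, hs, h2, critValue, critValue]; ring
    have : 0 ≤ (τ 1 - τ 0) ^ 3 * (2 * (τ 2 - τ 1) + (τ 1 - τ 0)) / 3 := by positivity
    linarith
  · have : critValue p s (τ 2) - critValue p s (τ 1)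
        = (τ 2 - τ 1) ^ 3 * (2 * (τ 1 - τ 0) + (τ 2 - τ 1)) / 3 := by
      rw [hp, hs, h2, critValue, critValue]; ring
    have : 0 ≤ (τ 2 - τ 1) ^ 3 * (2 * (τ 1 - τ 0) + (τ 2 - τ 1)) / 3 := by positivity
    linarith

lemma exists_hasRootsIn_depQuartic_iff (hlh : lo ≤ hi) {τ : Fin 3 → ℝ}
    (hτ : HasRootsIn lo hi (depCubic p s) τ) :
    (∃ r : Fin 4 → ℝ, HasRootsIn lo hi (depQuartic p s t) r) ↔
      (critValue p s (τ 1) ≤ t ∧ t ≤ min (critValue p s (τ 0)) (critValue p s (τ 2))) ∧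
      0 ≤ (depQuartic p s t).eval lo ∧ 0 ≤ (depQuartic p s t).eval hi := by
  rw [exists_hasRootsIn_iff hlh (depQuartic_monic p s t) (natDegree_depQuartic p s t)
      (derivative_depQuartic p s t) hτ]
  simp only [Fin.forall_fin_succ, IsEmpty.forall_iff, le_min_iff]
  simp [eval_depQuartic, Fin.succ_one_eq_two, pow_succ]
  tauto

lemma eval_depQuintic (x : ℝ) : (depQuintic p s t k).eval x = k - polyH p s t x := by
  simp [depQuintic, polyH]; ring

lemma exists_hasRootsIn_depQuintic_iff (hlh : lo ≤ hi) {γ : Fin 4 → ℝ}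
    (hγ : HasRootsIn lo hi (depQuartic p s t) γ) :
    (∃ r : Fin 5 → ℝ, HasRootsIn lo hi (depQuintic p s t k) r) ↔
      ((depQuintic p s t k).eval lo ≤ 0 ∧ 0 ≤ (depQuintic p s t k).eval hi) ∧
      (Lambda₁ p s t γ ≤ k ∧ k ≤ Lambda₂ p s t γ) := by
  rw [exists_hasRootsIn_iff hlh (depQuintic_monic p s t k) (natDegree_depQuintic p s t k)
      (derivative_depQuintic p s t k) hγ]
  simp only [Fin.forall_fin_succ, IsEmpty.forall_iff, Lambda₁, Lambda₂, le_min_iff, max_le_iff]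
  simp [eval_depQuintic, Fin.succ_one_eq_two, pow_succ]
  tauto

end Chain

/-! ### The multisets of Cardano and Ferrari -/

lemma IsSortedListing.unique {n : ℕ} {S : Multiset ℂ} {θ θ' : Fin n → ℝ}
    (h : IsSortedListing S θ) (h' : IsSortedListing S θ') : θ = θ' := by
  refine eq_of_monotone_of_map_eq h.1 h'.1 ?_
  apply Multiset.map_injective Complex.ofReal_injective
  rw [Multiset.map_map, Multiset.map_map]
  exact h.2.symm.trans h'.2

/-- The multiset of complex roots of a polynomial with all roots real. -/
lemma eq_map_ofReal_of_prod {n : ℕ} {P : ℝ[X]} {r : Fin n → ℝ} (h : P = ∏ i, (X - C (r i)))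
    {M : Multiset ℂ} (hM : (M.map fun a => X - C a).prod = P.map Complex.ofRealHom) :
    M = (Finset.univ : Finset (Fin n)).val.map fun i => ((r i : ℝ) : ℂ) := by
  rw [← roots_multiset_prod_X_sub_C M, hM, h, Polynomial.map_prod]
  have := roots_multiset_prod_X_sub_C
    ((Finset.univ : Finset (Fin n)).val.map fun i => ((r i : ℝ) : ℂ))
  rw [Multiset.map_map] at this
  rw [← this]
  simp only [Polynomial.map_sub, map_X, map_C]
  rfl

/-- When the cubic has three real roots, its discriminant makes `√Δ` purely imaginary, so that
`|ω|² = -u₂/3`, the roots are `ζᵏω + ζ⁻ᵏ(conj ω)`, and the elements of the Cardano multiset are the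
critical values at these roots. -/
lemma IsCardanoSet.eq_map_critValue {p s lo hi : ℝ} {S : Multiset ℂ} (hS : IsCardanoSet p s S)
    {τ : Fin 3 → ℝ} (hτ : HasRootsIn lo hi (depCubic p s) τ) :
    S = (Finset.univ : Finset (Fin 3)).val.map fun i => ((critValue p s (τ i) : ℝ) : ℂ) := by
  obtain ⟨d, ζ, ω, hd, hζ, hω, rfl⟩ := hS
  obtain ⟨h2, hp, hs⟩ := hτ.depCubic_coeffs
  have hΔ : s ^ 2 + 4 / 27 * p ^ 3 ≤ 0 := by
    have : s ^ 2 + 4 / 27 * p ^ 3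
        = -((τ 0 - τ 1) * (τ 0 - τ 2) * (τ 1 - τ 2)) ^ 2 / 27 := by
      rw [hp, hs, h2]; ring
    rw [this]
    have := sq_nonneg ((τ 0 - τ 1) * (τ 0 - τ 2) * (τ 1 - τ 2))
    linarith
  have hdc : starRingEnd ℂ d = -d := by
    have hre : d.re ^ 2 - d.im ^ 2 = s ^ 2 + 4 / 27 * p ^ 3 := by
      have := congrArg Complex.re hd
      rw [Complex.ofReal_re, sq, Complex.mul_re] at this
      linarith
    have him : d.re * d.im = 0 := by
      have := congrArg Complex.im hd
      rw [Complex.ofReal_im, sq, Complex.mul_im] at this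
      linarith
    have hd0 : d.re = 0 := by
      rcases mul_eq_zero.1 him with h | h
      · exact h
      · rw [h] at hre
        exact pow_eq_zero_iff two_ne_zero |>.1 (le_antisymm (by linarith) (sq_nonneg _))
    apply Complex.ext <;> simp [hd0]
  have hω' : starRingEnd ℂ ω ^ 3 = 1 / 2 * (-(s : ℂ) - d) := by
    rw [← map_pow, hω]; simp [hdc, map_ofNat]; ring
  push_cast at hd
  have hnorm : ω * starRingEnd ℂ ω = -(p : ℂ) / 3 := by
    have h3 : (ω * starRingEnd ℂ ω) ^ 3 = (-(p : ℂ) / 3) ^ 3 := by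
      rw [mul_pow, hω, hω']
      linear_combination (-1 / 4) * hd
    rw [Complex.mul_conj] at h3 ⊢
    have h4 : (Complex.normSq ω) ^ 3 = (-p / 3) ^ 3 := by exact_mod_cast h3
    have h5 := (Odd.strictMono_pow (R := ℝ) (n := 3) (by decide)).injective h4
    rw [h5]; push_cast; ring
  set ω' := starRingEnd ℂ ω
  have hζ3 : ζ ^ 3 = 1 := hζ.pow_eq_one
  have hζ2 : ζ ^ 2 + ζ + 1 = 0 := by
    have h1 : ζ ≠ 1 := hζ.ne_one (by norm_num)
    have : (ζ - 1) * (ζ ^ 2 + ζ + 1) = 0 := by linear_combination hζ3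
    exact (mul_eq_zero.1 this).resolve_left (sub_ne_zero.2 h1)
  have hζi : ζ⁻¹ = ζ ^ 2 := by
    refine inv_eq_of_mul_eq_one_right ?_
    linear_combination hζ3
  have hroots : (Multiset.range 3).map (fun k => ζ ^ k * ω + (ζ⁻¹) ^ k * ω')
      = (Finset.univ : Finset (Fin 3)).val.map fun i => ((τ i : ℝ) : ℂ) := by
    refine eq_map_ofReal_of_prod hτ.eq_prod ?_
    have e : (Multiset.range 3) = {0, 1, 2} := rfl
    rw [e]
    simp only [Multiset.insert_eq_cons, Multiset.map_cons, Multiset.map_singleton,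
      Multiset.prod_cons, Multiset.prod_singleton, hζi]
    refine Polynomial.funext fun x => ?_
    simp [depCubic]
    have z2 : ζ ^ 2 = -ζ - 1 := by linear_combination hζ2
    have z4 : (ζ ^ 2) ^ 2 = ζ := by linear_combination ζ * hζ3
    rw [z4, z2]
    have hp' : (p : ℂ) = -3 * (ω * ω') := by rw [hnorm]; ring
    have hs' : (s : ℂ) = -(ω ^ 3 + ω' ^ 3) := by rw [hω, hω']; ring
    rw [hp', hs']
    linear_combination (-(x - ω - ω') * (ω - ω') ^ 2) * hζ2
  have hg : ∀ i : Fin 3, ((critValue p s (τ i) : ℝ) : ℂ)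
      = (fun x : ℂ => -(x ^ 4 + 2 * p * x ^ 2 + 4 * s * x)) (τ i : ℂ) := by
    intro i; simp [critValue]
  simp only [hg]
  have := congrArg (Multiset.map fun x : ℂ => -(x ^ 4 + 2 * p * x ^ 2 + 4 * s * x)) hroots
  rw [Multiset.map_map, Multiset.map_map] at this
  refine Eq.trans ?_ this
  refine Multiset.map_congr rfl fun k _ => ?_
  have hk : ζ ^ k * (ζ⁻¹) ^ k = 1 := by
    rw [← mul_pow, mul_inv_cancel₀ (hζ.ne_zero (by norm_num)), one_pow]
  have hk3 : (ζ ^ k) ^ 3 = 1 := by rw [← pow_mul, mul_comm, pow_mul, hζ3, one_pow]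
  have hk3' : ((ζ⁻¹) ^ k) ^ 3 = 1 := by
    rw [← pow_mul, mul_comm, pow_mul, inv_pow, hζ3, inv_one, one_pow]
  simp only [Function.comp]
  generalize ζ ^ k = z at *
  generalize (ζ⁻¹) ^ k = z' at *
  have h3 : (z * ω) ^ 3 = 1 / 2 * (-(s : ℂ) + d) := by rw [mul_pow, hk3, hω, one_mul]
  have h3' : (z' * ω') ^ 3 = 1 / 2 * (-(s : ℂ) - d) := by rw [mul_pow, hk3', hω', one_mul]
  have hp' : (p : ℂ) = -3 * ((z * ω) * (z' * ω')) := by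
    linear_combination 3 * hnorm + 3 * ω * ω' * hk
  generalize z * ω = α at *
  generalize z' * ω' = β at *
  have hs' : (s : ℂ) = -(α ^ 3 + β ^ 3) := by rw [h3, h3']; ring
  have hd' : d = α ^ 3 - β ^ 3 := by rw [h3, h3']; ring
  rw [hp', hs', hd']
  ring

lemma isSortedListing_critValue {p s lo hi : ℝ} {S : Multiset ℂ} (hS : IsCardanoSet p s S)
    {τ : Fin 3 → ℝ} (hτ : HasRootsIn lo hi (depCubic p s) τ) :
    IsSortedListing S ![critValue p s (τ 1), min (critValue p s (τ 0)) (critValue p s (τ 2)),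
      max (critValue p s (τ 0)) (critValue p s (τ 2))] := by
  obtain ⟨h0, h2⟩ := hτ.critValue_le
  refine ⟨Fin.monotone_iff_le_succ.2 fun i => ?_, ?_⟩
  · fin_cases i
    · exact le_min h0 h2
    · exact min_le_max
  · rw [hS.eq_map_critValue hτ]
    have e : (Finset.univ : Finset (Fin 3)).val = {0, 1, 2} := rfl
    rw [e]
    simp only [Multiset.insert_eq_cons, Multiset.map_cons, Multiset.map_singleton]
    rw [Multiset.cons_swap]
    rcases le_total (critValue p s (τ 0)) (critValue p s (τ 2)) with h | h
    · simp [min_eq_left h, max_eq_right h]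
    · simp only [min_eq_right h, max_eq_left h]
      exact congrArg _ (Multiset.pair_comm _ _)

lemma units_int_prod_univ : (Finset.univ : Finset (ℤˣ × ℤˣ)).val
    = {(1, 1), (1, -1), (-1, 1), (-1, -1)} := by decide

/-- Ferrari's formula: the four numbers are the complex roots of the quartic. -/
lemma IsFerrariSet.prod_eq {p s t : ℝ} {M : Multiset ℂ} (hM : IsFerrariSet p s t M) :
    (M.map fun a => X - C a).prod = (depQuartic p s t).map Complex.ofRealHom := by
  rcases hM with ⟨rfl, w, a, hw, ha, rfl⟩ | ⟨hs, v₂, v₃, e, c, y, σ, a, hv2, hv3, he, hc0, hc1,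
    hy, hσ, ha, rfl⟩
  · have h1 := ha 1
    have h2 := ha (-1)
    rw [units_int_prod_univ]
    refine Polynomial.funext fun x => ?_
    simp [depQuartic]
    simp at h1 h2
    push_cast at hw
    generalize a 1 = b at *
    generalize a (-1) = b' at *
    linear_combination (-x ^ 2 + b' ^ 2) * h1 + (-x ^ 2 - p + w) * h2 - hw
  · have h1 := ha 1
    have h2 := ha (-1)
    simp at h1 h2
    have hsc : (s : ℂ) ≠ 0 := by exact_mod_cast hs
    -- `z = c - v₂/(3c)` is a root of the depressed resolvent cubic.
    have hz : (c - v₂ / (3 * c)) ^ 3 + v₂ * (c - v₂ / (3 * c)) + v₃ = 0 := by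
      by_cases hv : v₂ = 0
      · simp [hv, hc0 hv]
      · have h3 := hc1 hv
        push_cast at he
        have hvc : (v₂ : ℂ) ≠ 0 := by exact_mod_cast hv
        have hprod : c ^ 3 * (1 / 2 * (-(v₃ : ℂ) - e)) = -(v₂ : ℂ) ^ 3 / 27 := by
          rw [h3]; linear_combination (-1 / 4) * he
        have hc : c ≠ 0 := by
          rintro rfl
          have : (v₂ : ℂ) ^ 3 = 0 := by linear_combination 27 * hprod
          exact hvc (pow_eq_zero_iff three_ne_zero |>.1 this)
        have hq : c ^ 6 + v₃ * c ^ 3 - (v₂ : ℂ) ^ 3 / 27 = 0 := by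
          have he' : e = 2 * c ^ 3 + v₃ := by rw [h3]; ring
          rw [he'] at hprod
          linear_combination -hprod
        field_simp
        linear_combination 27 * hq
    have hres : y * (y + p) ^ 2 - 2 * s ^ 2 = t * y := by
      have : c - v₂ / (3 * c) = y + 2 * p / 3 := by rw [hy]; ring
      rw [this, hv2, hv3] at hz
      push_cast at hz
      linear_combination hz
    have hy0 : y ≠ 0 := by
      rintro rfl
      have : (s : ℂ) ^ 2 = 0 := by linear_combination (-1 / 2) * hres
      exact hsc (pow_eq_zero_iff two_ne_zero |>.1 this)
    have hσ0 : σ ≠ 0 := by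
      rintro rfl
      apply hy0
      linear_combination (-1 / 2) * hσ
    rw [units_int_prod_univ]
    refine Polynomial.funext fun x => ?_
    simp [depQuartic]
    generalize a 1 = b at *
    generalize a (-1) = b' at *
    obtain ⟨β, hβ⟩ : ∃ β : ℂ, β = 2 * s / σ := ⟨_, rfl⟩
    have hβσ : β * σ = 2 * s := by rw [hβ]; field_simp
    have h8 : 8 * (s : ℂ) / σ = 4 * β := by rw [hβ]; ring
    rw [h8] at h1 h2
    have hβ2 : β ^ 2 = (y + p) ^ 2 - t := by
      have h4 : β ^ 2 * (2 * y) = 4 * s ^ 2 := by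
        rw [← hσ]; linear_combination (β * σ + 2 * s) * hβσ
      refine mul_right_cancel₀ (mul_ne_zero two_ne_zero hy0) (h4.trans ?_)
      linear_combination (-2) * hres
    have f1 : (x - (σ + b) / 2) * (x - (σ + -b) / 2) = x ^ 2 - σ * x + (y + p) + β := by
      linear_combination (-1 / 4) * h1 + (1 / 4) * hσ
    have f2 : (x - (-σ + b') / 2) * (x - (-σ + -b') / 2) = x ^ 2 + σ * x + (y + p) - β := by
      linear_combination (-1 / 4) * h2 + (1 / 4) * hσ
    calc _ = ((x - (σ + b) / 2) * (x - (σ + -b) / 2))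
          * ((x - (-σ + b') / 2) * (x - (-σ + -b') / 2)) := by ring
      _ = _ := by
        rw [f1, f2]
        linear_combination (-x ^ 2) * hσ + 2 * x * hβσ - hβ2

lemma HasRootsIn.isSortedListing_ferrari {p s t lo hi : ℝ} {M : Multiset ℂ}
    (hM : IsFerrariSet p s t M) {γ : Fin 4 → ℝ} (hγ : HasRootsIn lo hi (depQuartic p s t) γ) :
    IsSortedListing M γ :=
  ⟨hγ.mono, eq_map_ofReal_of_prod hγ.eq_prod hM.prod_eq⟩

/-! ### The inequalities as sign conditions -/

section Conditions

variable {q a₁ a₂ a₃ a₄ a₅ : ℝ}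

/-- The constant term of the depressed quintic is `a₅ - A`. -/
noncomputable def depConst (q a₁ a₂ a₃ a₄ a₅ : ℝ) : ℝ := a₅ - constA q a₁ a₂ a₃ a₄

lemma eval_depQuadratic_lo (hq : 0 ≤ q) :
    10 * ((a₁ / 5 - 2 * √q) ^ 2 + u₂ q a₁ a₂ / 3) = a₂ + 35 * q - 8 * √q * a₁ := by
  have h := Real.sq_sqrt hq
  unfold u₂
  linear_combination 40 * h

lemma eval_depQuadratic_hi (hq : 0 ≤ q) :
    10 * ((a₁ / 5 + 2 * √q) ^ 2 + u₂ q a₁ a₂ / 3) = a₂ + 35 * q + 8 * √q * a₁ := by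
  have h := Real.sq_sqrt hq
  unfold u₂
  linear_combination 40 * h

lemma eval_depCubic_lo (hq : 0 ≤ q) :
    10 * (depCubic (u₂ q a₁ a₂) (u₃ q a₁ a₂ a₃)).eval (a₁ / 5 - 2 * √q)
      = a₃ - upperD q a₁ a₂ := by
  obtain ⟨R, hR, rfl⟩ : ∃ R, 0 ≤ R ∧ q = R ^ 2 := ⟨√q, Real.sqrt_nonneg q, (Real.sq_sqrt hq).symm⟩
  simp [depCubic, upperD, u₂, u₃, Real.sqrt_sq hR]; ring

lemma eval_depCubic_hi (hq : 0 ≤ q) :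
    10 * (depCubic (u₂ q a₁ a₂) (u₃ q a₁ a₂ a₃)).eval (a₁ / 5 + 2 * √q)
      = a₃ - lowerD q a₁ a₂ := by
  obtain ⟨R, hR, rfl⟩ : ∃ R, 0 ≤ R ∧ q = R ^ 2 := ⟨√q, Real.sqrt_nonneg q, (Real.sq_sqrt hq).symm⟩
  simp [depCubic, lowerD, u₂, u₃, Real.sqrt_sq hR]; ring

lemma eval_depQuartic_lo (hq : 0 ≤ q) :
    5 * (depQuartic (u₂ q a₁ a₂) (u₃ q a₁ a₂ a₃) (u₄ q a₁ a₂ a₃ a₄)).eval (a₁ / 5 - 2 * √q)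
      = a₄ + 9 * q * a₂ + 25 * q ^ 2 - 4 * √q * (4 * q * a₁ + a₃) := by
  obtain ⟨R, hR, rfl⟩ : ∃ R, 0 ≤ R ∧ q = R ^ 2 := ⟨√q, Real.sqrt_nonneg q, (Real.sq_sqrt hq).symm⟩
  simp [depQuartic, u₂, u₃, u₄, Real.sqrt_sq hR]; ring

lemma eval_depQuartic_hi (hq : 0 ≤ q) :
    5 * (depQuartic (u₂ q a₁ a₂) (u₃ q a₁ a₂ a₃) (u₄ q a₁ a₂ a₃ a₄)).eval (a₁ / 5 + 2 * √q)
      = a₄ + 9 * q * a₂ + 25 * q ^ 2 + 4 * √q * (4 * q * a₁ + a₃) := by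
  obtain ⟨R, hR, rfl⟩ : ∃ R, 0 ≤ R ∧ q = R ^ 2 := ⟨√q, Real.sqrt_nonneg q, (Real.sq_sqrt hq).symm⟩
  simp [depQuartic, u₂, u₃, u₄, Real.sqrt_sq hR]; ring

lemma eval_depQuintic_lo (hq : 0 ≤ q) :
    (depQuintic (u₂ q a₁ a₂) (u₃ q a₁ a₂ a₃) (u₄ q a₁ a₂ a₃ a₄)
      (depConst q a₁ a₂ a₃ a₄ a₅)).eval (a₁ / 5 - 2 * √q) = a₅ - upperG q a₁ a₂ a₃ a₄ := by
  obtain ⟨R, hR, rfl⟩ : ∃ R, 0 ≤ R ∧ q = R ^ 2 := ⟨√q, Real.sqrt_nonneg q, (Real.sq_sqrt hq).symm⟩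
  simp [depQuintic, u₂, u₃, u₄, depConst, constA, upperG, Real.sqrt_sq hR]; ring

lemma eval_depQuintic_hi (hq : 0 ≤ q) :
    (depQuintic (u₂ q a₁ a₂) (u₃ q a₁ a₂ a₃) (u₄ q a₁ a₂ a₃ a₄)
      (depConst q a₁ a₂ a₃ a₄ a₅)).eval (a₁ / 5 + 2 * √q) = a₅ - lowerG q a₁ a₂ a₃ a₄ := by
  obtain ⟨R, hR, rfl⟩ : ∃ R, 0 ≤ R ∧ q = R ^ 2 := ⟨√q, Real.sqrt_nonneg q, (Real.sq_sqrt hq).symm⟩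
  simp [depQuintic, u₂, u₃, u₄, depConst, constA, lowerG, Real.sqrt_sq hR]; ring

lemma condA_iff : CondA q a₁ ↔ a₁ / 5 - 2 * √q ≤ 0 ∧ 0 ≤ a₁ / 5 + 2 * √q := by
  unfold CondA
  rw [abs_le]
  constructor <;> rintro ⟨h1, h2⟩ <;> constructor <;> linarith

lemma condBStar_iff (hq : 0 ≤ q) : CondBStar q a₁ a₂ ↔
    0 ≤ (a₁ / 5 - 2 * √q) ^ 2 + u₂ q a₁ a₂ / 3 ∧ 0 ≤ (a₁ / 5 + 2 * √q) ^ 2 + u₂ q a₁ a₂ / 3 := by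
  have h1 := eval_depQuadratic_lo (a₁ := a₁) (a₂ := a₂) hq
  have h2 := eval_depQuadratic_hi (a₁ := a₁) (a₂ := a₂) hq
  have h3 : 8 * √q * |a₁| = |8 * √q * a₁| := by
    rw [abs_mul, abs_of_nonneg (by positivity : 0 ≤ 8 * √q)]
  unfold CondBStar
  rw [h3, sub_le_iff_le_add, abs_le]
  constructor <;> rintro ⟨h4, h5⟩ <;> constructor <;> linarith

lemma condB_iff : CondB q a₁ a₂ ↔ u₂ q a₁ a₂ ≤ 0 := by
  unfold CondB u₂
  constructor <;> intro h <;> linarith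

lemma radicandC_eq : radicandC q a₁ a₂ = 10 ^ 2 * (-u₂ q a₁ a₂ / 3) := by
  unfold radicandC u₂; ring

lemma radicandC_nonneg (h : CondB q a₁ a₂) : 0 ≤ radicandC q a₁ a₂ := by
  rw [radicandC_eq]
  have := condB_iff.1 h
  linarith

lemma condC_iff (h : CondB q a₁ a₂) :
    CondC q a₁ a₂ a₃ ↔ |u₃ q a₁ a₂ a₃| ≤ 2 * √(-u₂ q a₁ a₂ / 3) ^ 3 := by
  have h0 : 0 ≤ -u₂ q a₁ a₂ / 3 := by have := condB_iff.1 h; linarith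
  have hr : radicandC q a₁ a₂ ^ (3 / 2 : ℝ) = 1000 * √(-u₂ q a₁ a₂ / 3) ^ 3 := by
    rw [show (3 / 2 : ℝ) = 1 / 2 * (3 : ℕ) by norm_num, Real.rpow_mul (radicandC_nonneg h),
      Real.rpow_natCast, ← Real.sqrt_eq_rpow, radicandC_eq, Real.sqrt_mul (by norm_num),
      Real.sqrt_sq (by norm_num)]
    ring
  have hu : 10 * u₃ q a₁ a₂ a₃ = a₃ - (-(4 / 25) * a₁ ^ 3 + 3 / 5 * a₁ * a₂ + q * a₁) := by
    unfold u₃; ring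
  unfold CondC
  rw [hr, abs_le]
  constructor <;> rintro ⟨h1, h2⟩ <;> constructor <;> linarith

lemma condD_iff (hq : 0 ≤ q) : CondD q a₁ a₂ a₃ ↔
    (depCubic (u₂ q a₁ a₂) (u₃ q a₁ a₂ a₃)).eval (a₁ / 5 - 2 * √q) ≤ 0 ∧
    0 ≤ (depCubic (u₂ q a₁ a₂) (u₃ q a₁ a₂ a₃)).eval (a₁ / 5 + 2 * √q) := by
  have h1 := eval_depCubic_lo (a₁ := a₁) (a₂ := a₂) (a₃ := a₃) hq
  have h2 := eval_depCubic_hi (a₁ := a₁) (a₂ := a₂) (a₃ := a₃) hq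
  unfold CondD
  constructor <;> rintro ⟨h3, h4⟩ <;> constructor <;> linarith

lemma lo_le_hi : a₁ / 5 - 2 * √q ≤ a₁ / 5 + 2 * √q := by
  have := Real.sqrt_nonneg q
  linarith

lemma condsAToD_iff (hq : 0 ≤ q) : CondsAToD q a₁ a₂ a₃ ↔
    ∃ r : Fin 3 → ℝ, HasRootsIn (a₁ / 5 - 2 * √q) (a₁ / 5 + 2 * √q)
      (depCubic (u₂ q a₁ a₂) (u₃ q a₁ a₂ a₃)) r := by
  rw [exists_hasRootsIn_depCubic_iff lo_le_hi, ← condA_iff, ← condBStar_iff hq, ← condB_iff,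
    ← condD_iff hq]
  unfold CondsAToD
  constructor
  · rintro ⟨ha, hbs, hb, hc, hd⟩
    exact ⟨⟨ha, hbs, hb⟩, hd, (condC_iff hb).1 hc⟩
  · rintro ⟨⟨ha, hbs, hb⟩, hd, hc⟩
    exact ⟨ha, hbs, hb, (condC_iff hb).2 hc, hd⟩

lemma condE_iff {θ₁ θ₂ : ℝ} : CondE q a₁ a₂ a₃ a₄ θ₁ θ₂ ↔
    θ₁ ≤ u₄ q a₁ a₂ a₃ a₄ ∧ u₄ q a₁ a₂ a₃ a₄ ≤ θ₂ := by
  unfold CondE u₄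
  constructor <;> rintro ⟨h1, h2⟩ <;> constructor <;> linarith

lemma condF_iff (hq : 0 ≤ q) : CondF q a₁ a₂ a₃ a₄ ↔
    0 ≤ (depQuartic (u₂ q a₁ a₂) (u₃ q a₁ a₂ a₃) (u₄ q a₁ a₂ a₃ a₄)).eval (a₁ / 5 - 2 * √q) ∧
    0 ≤ (depQuartic (u₂ q a₁ a₂) (u₃ q a₁ a₂ a₃) (u₄ q a₁ a₂ a₃ a₄)).eval (a₁ / 5 + 2 * √q) := by
  have h1 := eval_depQuartic_lo (a₁ := a₁) (a₂ := a₂) (a₃ := a₃) (a₄ := a₄) hq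
  have h2 := eval_depQuartic_hi (a₁ := a₁) (a₂ := a₂) (a₃ := a₃) (a₄ := a₄) hq
  have h3 : 4 * √q * |4 * q * a₁ + a₃| = |4 * √q * (4 * q * a₁ + a₃)| := by
    rw [abs_mul, abs_of_nonneg (by positivity : 0 ≤ 4 * √q)]
  unfold CondF lowerF
  rw [h3, sub_le_iff_le_add, sub_le_iff_le_add, abs_le]
  constructor <;> rintro ⟨h4, h5⟩ <;> constructor <;> linarith

lemma condG_iff (hq : 0 ≤ q) : CondG q a₁ a₂ a₃ a₄ a₅ ↔
    (depQuintic (u₂ q a₁ a₂) (u₃ q a₁ a₂ a₃) (u₄ q a₁ a₂ a₃ a₄)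
      (depConst q a₁ a₂ a₃ a₄ a₅)).eval (a₁ / 5 - 2 * √q) ≤ 0 ∧
    0 ≤ (depQuintic (u₂ q a₁ a₂) (u₃ q a₁ a₂ a₃) (u₄ q a₁ a₂ a₃ a₄)
      (depConst q a₁ a₂ a₃ a₄ a₅)).eval (a₁ / 5 + 2 * √q) := by
  rw [eval_depQuintic_lo hq, eval_depQuintic_hi hq, sub_nonneg, sub_nonpos, and_comm]
  rfl

lemma condH_iff {γ : Fin 4 → ℝ} : CondH q a₁ a₂ a₃ a₄ a₅ γ ↔
    Lambda₁ (u₂ q a₁ a₂) (u₃ q a₁ a₂ a₃) (u₄ q a₁ a₂ a₃ a₄) γ ≤ depConst q a₁ a₂ a₃ a₄ a₅ ∧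
    depConst q a₁ a₂ a₃ a₄ a₅ ≤ Lambda₂ (u₂ q a₁ a₂) (u₃ q a₁ a₂ a₃) (u₄ q a₁ a₂ a₃ a₄) γ := by
  unfold CondH depConst
  rw [le_sub_iff_add_le, sub_le_iff_le_add]

variable {S M : Multiset ℂ}

lemma condsAToF_iff (hq : 0 ≤ q) (hS : IsCardanoSet (u₂ q a₁ a₂) (u₃ q a₁ a₂ a₃) S) :
    (CondsAToD q a₁ a₂ a₃ ∧
      (∃ θ : Fin 3 → ℝ, IsSortedListing S θ ∧ CondE q a₁ a₂ a₃ a₄ (θ 0) (θ 1)) ∧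
      CondF q a₁ a₂ a₃ a₄) ↔
    ∃ r : Fin 4 → ℝ, HasRootsIn (a₁ / 5 - 2 * √q) (a₁ / 5 + 2 * √q)
      (depQuartic (u₂ q a₁ a₂) (u₃ q a₁ a₂ a₃) (u₄ q a₁ a₂ a₃ a₄)) r := by
  rw [condsAToD_iff hq, condF_iff hq]
  simp only [condE_iff]
  constructor
  · rintro ⟨⟨τ, hτ⟩, ⟨θ, hθ, hE⟩, hF⟩
    obtain rfl := hθ.unique (isSortedListing_critValue hS hτ)
    exact (exists_hasRootsIn_depQuartic_iff lo_le_hi hτ).2 ⟨hE, hF⟩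
  · rintro ⟨r, hr⟩
    obtain ⟨τ, hτ, -⟩ := hr.exists_derivative (depCubic_monic _ _) (natDegree_depCubic _ _)
      (derivative_depQuartic _ _ _)
    have h := (exists_hasRootsIn_depQuartic_iff lo_le_hi hτ).1 ⟨r, hr⟩
    exact ⟨⟨τ, hτ⟩, ⟨_, isSortedListing_critValue hS hτ, h.1⟩, h.2⟩

lemma condsAToH_iff (hq : 0 ≤ q) (hS : IsCardanoSet (u₂ q a₁ a₂) (u₃ q a₁ a₂ a₃) S)
    (hM : IsFerrariSet (u₂ q a₁ a₂) (u₃ q a₁ a₂ a₃) (u₄ q a₁ a₂ a₃ a₄) M) :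
    (CondsAToD q a₁ a₂ a₃ ∧
      (∃ θ : Fin 3 → ℝ, IsSortedListing S θ ∧ CondE q a₁ a₂ a₃ a₄ (θ 0) (θ 1)) ∧
      CondF q a₁ a₂ a₃ a₄ ∧ CondG q a₁ a₂ a₃ a₄ a₅ ∧
      ∃ γ : Fin 4 → ℝ, IsSortedListing M γ ∧ CondH q a₁ a₂ a₃ a₄ a₅ γ) ↔
    ∃ r : Fin 5 → ℝ, HasRootsIn (a₁ / 5 - 2 * √q) (a₁ / 5 + 2 * √q)
      (depQuintic (u₂ q a₁ a₂) (u₃ q a₁ a₂ a₃) (u₄ q a₁ a₂ a₃ a₄)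
        (depConst q a₁ a₂ a₃ a₄ a₅)) r := by
  rw [condG_iff hq]
  simp only [condH_iff]
  constructor
  · rintro ⟨hD, hE, hF, hG, γ, hγ, hH⟩
    obtain ⟨γ', hγ'⟩ := (condsAToF_iff hq hS).1 ⟨hD, hE, hF⟩
    obtain rfl := hγ.unique (hγ'.isSortedListing_ferrari hM)
    exact (exists_hasRootsIn_depQuintic_iff lo_le_hi hγ').2 ⟨hG, hH⟩
  · rintro ⟨r, hr⟩
    obtain ⟨γ, hγ, -⟩ := hr.exists_derivative (depQuartic_monic _ _ _)
      (natDegree_depQuartic _ _ _) (derivative_depQuintic _ _ _ _)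
    have h := (exists_hasRootsIn_depQuintic_iff lo_le_hi hγ).1 ⟨r, hr⟩
    obtain ⟨hD, hE, hF⟩ := (condsAToF_iff hq hS).2 ⟨γ, hγ⟩
    exact ⟨hD, hE, hF, h.1, γ, hγ.isSortedListing_ferrari hM, h.2⟩

/-- Equality in one of the end point inequalities means that some polynomial of the derivative
chain vanishes at an end point; since all roots stay inside the interval, the vanishing climbs up
the chain to the quintic. -/
lemma someEquality_iff (hq : 0 ≤ q) {r : Fin 5 → ℝ}
    (hr : HasRootsIn (a₁ / 5 - 2 * √q) (a₁ / 5 + 2 * √q)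
      (depQuintic (u₂ q a₁ a₂) (u₃ q a₁ a₂ a₃) (u₄ q a₁ a₂ a₃ a₄)
        (depConst q a₁ a₂ a₃ a₄ a₅)) r) :
    SomeEquality q a₁ a₂ a₃ a₄ a₅ ↔
      (depQuintic (u₂ q a₁ a₂) (u₃ q a₁ a₂ a₃) (u₄ q a₁ a₂ a₃ a₄)
        (depConst q a₁ a₂ a₃ a₄ a₅)).eval (a₁ / 5 - 2 * √q) = 0 ∨
      (depQuintic (u₂ q a₁ a₂) (u₃ q a₁ a₂ a₃) (u₄ q a₁ a₂ a₃ a₄)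
        (depConst q a₁ a₂ a₃ a₄ a₅)).eval (a₁ / 5 + 2 * √q) = 0 := by
  constructor
  · obtain ⟨r₄, h₄, -⟩ := hr.exists_derivative (depQuartic_monic _ _ _)
      (natDegree_depQuartic _ _ _) (derivative_depQuintic _ _ _ _)
    obtain ⟨r₃, h₃, -⟩ := h₄.exists_derivative (depCubic_monic _ _) (natDegree_depCubic _ _)
      (derivative_depQuartic _ _ _)
    obtain ⟨r₂, h₂, -⟩ := h₃.exists_derivative (depQuadratic_monic _) (natDegree_depQuadratic _)
      (derivative_depCubic _ _)
    have lo4 := hr.eval_lo_eq_zero (depQuartic_monic _ _ _)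
      (natDegree_depQuartic _ _ _) (derivative_depQuintic _ _ _ _)
    have hi4 := hr.eval_hi_eq_zero (depQuartic_monic _ _ _)
      (natDegree_depQuartic _ _ _) (derivative_depQuintic _ _ _ _)
    have lo3 := fun h => lo4 (h₄.eval_lo_eq_zero (depCubic_monic _ _) (natDegree_depCubic _ _)
      (derivative_depQuartic _ _ _) h)
    have hi3 := fun h => hi4 (h₄.eval_hi_eq_zero (depCubic_monic _ _) (natDegree_depCubic _ _)
      (derivative_depQuartic _ _ _) h)
    have lo2 := fun h => lo3 (h₃.eval_lo_eq_zero (depQuadratic_monic _) (natDegree_depQuadratic _)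
      (derivative_depCubic _ _) h)
    have hi2 := fun h => hi3 (h₃.eval_hi_eq_zero (depQuadratic_monic _) (natDegree_depQuadratic _)
      (derivative_depCubic _ _) h)
    have lo1 := fun h => lo2 (h₂.eval_lo_eq_zero monic_X natDegree_X (derivative_depQuadratic _) h)
    have hi1 := fun h => hi2 (h₂.eval_hi_eq_zero monic_X natDegree_X (derivative_depQuadratic _) h)
    have e2l := eval_depQuadratic_lo (a₁ := a₁) (a₂ := a₂) hq
    have e2h := eval_depQuadratic_hi (a₁ := a₁) (a₂ := a₂) hq
    have e3l := eval_depCubic_lo (a₁ := a₁) (a₂ := a₂) (a₃ := a₃) hq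
    have e3h := eval_depCubic_hi (a₁ := a₁) (a₂ := a₂) (a₃ := a₃) hq
    have e4l := eval_depQuartic_lo (a₁ := a₁) (a₂ := a₂) (a₃ := a₃) (a₄ := a₄) hq
    have e4h := eval_depQuartic_hi (a₁ := a₁) (a₂ := a₂) (a₃ := a₃) (a₄ := a₄) hq
    simp only [eval_X] at lo1 hi1
    have e2 : ∀ x, (depQuadratic (u₂ q a₁ a₂)).eval x = x ^ 2 + u₂ q a₁ a₂ / 3 := by
      intro x; simp [depQuadratic]
    rw [e2] at lo2 hi2
    rintro (h | h | (h | h) | h | h)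
    · rcases abs_choice a₁ with ha | ha <;> rw [ha] at h
      · exact Or.inl (lo1 (by linarith))
      · exact Or.inr (hi1 (by linarith))
    · rcases abs_choice a₁ with ha | ha <;> rw [ha] at h
      · exact Or.inl (lo2 (by linarith))
      · exact Or.inr (hi2 (by linarith))
    · exact Or.inr (hi3 (by linarith))
    · exact Or.inl (lo3 (by linarith))
    · unfold lowerF at h
      rcases abs_choice (4 * q * a₁ + a₃) with ha | ha <;> rw [ha] at h
      · exact Or.inl (lo4 (by linarith))
      · exact Or.inr (hi4 (by linarith))
    · rw [eval_depQuintic_lo hq, eval_depQuintic_hi hq, sub_eq_zero, sub_eq_zero]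
      exact h.symm.imp_right Eq.symm
  · rw [eval_depQuintic_lo hq, eval_depQuintic_hi hq, sub_eq_zero, sub_eq_zero]
    intro h
    exact Or.inr (Or.inr (Or.inr (Or.inr (h.symm.imp_left Eq.symm))))

end Conditions

/-! ### Weil polynomials and real Weil polynomials -/

/-- The real quadratic `x² - tx + q`; for `|t| ≤ 2√q` its roots are `w, conj w` with `|w| = √q`. -/
noncomputable def weilFactor (q : ℕ) (t : ℝ) : ℝ[X] := X ^ 2 - C t * X + C (q : ℝ)

lemma weilFactor_monic (q : ℕ) (t : ℝ) : (weilFactor q t).Monic := by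
  unfold weilFactor; monicity!

lemma natDegree_weilFactor (q : ℕ) (t : ℝ) : (weilFactor q t).natDegree = 2 := by
  unfold weilFactor; compute_degree!

lemma map_weilFactor {q : ℕ} {w : ℂ} (hw : ‖w‖ = √(q : ℝ)) :
    (weilFactor q (2 * w.re)).map Complex.ofRealHom
      = (X - C w) * (X - C (starRingEnd ℂ w)) := by
  have h1 : w * starRingEnd ℂ w = q := by
    rw [Complex.mul_conj, Complex.normSq_eq_norm_sq, hw, Real.sq_sqrt (Nat.cast_nonneg q)]
    simp
  have h2 : w + starRingEnd ℂ w = 2 * w.re := by rw [Complex.add_conj]; simp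
  refine Polynomial.funext fun x => ?_
  simp [weilFactor]
  linear_combination x * h2 - h1

/-- `h` is a `q`-Weil polynomial if and only if it is a product of real quadratics `x² - tx + q`
with `|t| ≤ 2√q`. -/
theorem mem_weilPolys_iff {q g : ℕ} {h : ℤ[X]} : h ∈ WeilPolys q g ↔
    0 < g ∧ ∃ t : Fin g → ℝ, (∀ i, |t i| ≤ 2 * √(q : ℝ)) ∧
      h.map (Int.castRingHom ℝ) = ∏ i, weilFactor q (t i) := by
  have hcomp : h.map (algebraMap ℤ ℂ) = (h.map (Int.castRingHom ℝ)).map Complex.ofRealHom := by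
    rw [Polynomial.map_map]; rfl
  constructor
  · rintro ⟨hg, hm, hd, w, hw, hr⟩
    refine ⟨hg, fun i => 2 * (w i).re, fun i => ?_, ?_⟩
    · rw [abs_mul, abs_two, ← hw i]
      exact mul_le_mul_of_nonneg_left (Complex.abs_re_le_norm _) zero_le_two
    · apply Polynomial.map_injective _ Complex.ofRealHom.injective
      rw [← hcomp, Polynomial.map_prod]
      have hm' := hm.map (algebraMap ℤ ℂ)
      rw [aroots_def] at hr
      have := prod_multiset_X_sub_C_of_monic_of_roots_card_eq hm' (by
        rw [hr, hm.natDegree_map, hd]; simp [mul_comm])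
      have hsum := map_sum (Multiset.mapAddMonoidHom fun a : ℂ => X - C a)
        (fun i => ({w i, starRingEnd ℂ (w i)} : Multiset ℂ)) Finset.univ
      simp only [Multiset.coe_mapAddMonoidHom] at hsum
      rw [← this, hr, hsum, Multiset.prod_sum]
      refine Finset.prod_congr rfl fun i _ => ?_
      rw [map_weilFactor (hw i)]
      simp
  · rintro ⟨hg, t, ht, hprod⟩
    have hm' : (∏ i, weilFactor q (t i)).Monic :=
      monic_prod_of_monic _ _ fun _ _ => weilFactor_monic q _
    have hinj : Function.Injective (Int.castRingHom ℝ) := Int.cast_injective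
    refine ⟨hg, ?_, ?_, fun i => ⟨t i / 2, √(q - (t i / 2) ^ 2)⟩, ?_, ?_⟩
    · rw [← hprod] at hm'
      exact monic_of_injective hinj hm'
    · rw [← natDegree_map_eq_of_injective hinj, hprod,
        natDegree_prod_of_monic _ _ fun _ _ => weilFactor_monic q _]
      simp [natDegree_weilFactor, mul_comm]
    all_goals
      have hw : ∀ i, ‖(⟨t i / 2, √(q - (t i / 2) ^ 2)⟩ : ℂ)‖ = √(q : ℝ) := by
        intro i
        have h1 := sq_le_sq' (abs_le.1 (ht i)).1 (abs_le.1 (ht i)).2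
        rw [mul_pow, Real.sq_sqrt (Nat.cast_nonneg q)] at h1
        rw [Complex.norm_def, Complex.normSq_mk, Real.mul_self_sqrt (by linarith)]
        congr 1; ring
    · exact hw
    · rw [aroots_def, hcomp, hprod, Polynomial.map_prod, roots_prod]
      · refine Finset.sum_congr rfl fun i _ => ?_
        have := map_weilFactor (hw i)
        simp only [mul_div_cancel₀ (t i) (two_ne_zero' ℝ)] at this
        rw [this, roots_mul (mul_ne_zero (X_sub_C_ne_zero _) (X_sub_C_ne_zero _)),
          roots_X_sub_C, roots_X_sub_C]
        rfl
      · exact Finset.prod_ne_zero_iff.2 fun i _ => ((weilFactor_monic q _).map _).ne_zero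

/-- The substitution `h(x) = x⁵ f(x + q/x)`, where `f` is the depressed quintic shifted by
`a₁/5`. -/
lemma eval_weilShape {q : ℕ} {a₁ a₂ a₃ a₄ a₅ : ℤ} {x : ℝ} (hx : x ≠ 0) :
    ((weilShape q a₁ a₂ a₃ a₄ a₅).map (Int.castRingHom ℝ)).eval x
      = x ^ 5 * (depQuintic (u₂ q a₁ a₂) (u₃ q a₁ a₂ a₃) (u₄ q a₁ a₂ a₃ a₄)
        (depConst q a₁ a₂ a₃ a₄ a₅)).eval (x + q / x + a₁ / 5) := by
  simp [weilShape, depQuintic, u₂, u₃, u₄, depConst, constA]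
  field_simp
  ring

lemma eval_prod_weilFactor {q g : ℕ} (t : Fin g → ℝ) (c : ℝ) {x : ℝ} (hx : x ≠ 0) :
    (∏ i, weilFactor q (t i)).eval x
      = x ^ g * (∏ i, (X - C (t i + c))).eval (x + q / x + c) := by
  have : x ^ g = ∏ _i : Fin g, x := by simp
  rw [this, eval_prod, eval_prod, ← Finset.prod_mul_distrib]
  refine Finset.prod_congr rfl fun i _ => ?_
  simp [weilFactor]
  field_simp
  ring

lemma weilShape_eq_prod_iff {q : ℕ} {a₁ a₂ a₃ a₄ a₅ : ℤ} (t : Fin 5 → ℝ) :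
    (weilShape q a₁ a₂ a₃ a₄ a₅).map (Int.castRingHom ℝ) = ∏ i, weilFactor q (t i) ↔
      depQuintic (u₂ q a₁ a₂) (u₃ q a₁ a₂ a₃) (u₄ q a₁ a₂ a₃ a₄)
        (depConst q a₁ a₂ a₃ a₄ a₅) = ∏ i, (X - C (t i + a₁ / 5)) := by
  constructor
  · intro h
    -- Every real number `y ≥ 2√q` has the form `x + q/x`.
    refine eq_of_infinite_eval_eq _ _ ((Set.Ioi_infinite (2 * √(q : ℝ) + a₁ / 5)).mono ?_)
    intro y hy
    have hy' : 2 * √(q : ℝ) < y - a₁ / 5 := by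
      have : 2 * √(q : ℝ) + a₁ / 5 < y := hy
      linarith
    have hpos : 0 < y - a₁ / 5 := lt_of_le_of_lt (by positivity) hy'
    have hdisc : 0 ≤ (y - a₁ / 5) ^ 2 - 4 * q := by
      have h1 := pow_le_pow_left₀ (by positivity) hy'.le 2
      rw [mul_pow, Real.sq_sqrt (Nat.cast_nonneg q)] at h1
      linarith
    set z := √((y - a₁ / 5) ^ 2 - 4 * q)
    have hz : z ^ 2 = (y - a₁ / 5) ^ 2 - 4 * q := Real.sq_sqrt hdisc
    have hx : (y - a₁ / 5 + z) / 2 ≠ 0 := by positivity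
    have hxy : (y - a₁ / 5 + z) / 2 + q / ((y - a₁ / 5 + z) / 2) + a₁ / 5 = y := by
      have : (q : ℝ) / ((y - a₁ / 5 + z) / 2) = (y - a₁ / 5 - z) / 2 := by
        rw [div_eq_iff hx]
        linear_combination (1 / 4) * hz
      rw [this]
      ring
    have h2 := congrArg (eval ((y - a₁ / 5 + z) / 2)) h
    rw [eval_weilShape hx, eval_prod_weilFactor t (a₁ / 5) hx, hxy] at h2
    exact mul_left_cancel₀ (pow_ne_zero 5 hx) h2
  · intro h
    refine eq_of_infinite_eval_eq _ _ ((Set.Ioi_infinite (0 : ℝ)).mono ?_)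
    intro x hx
    have hx' : x ≠ 0 := ne_of_gt hx
    change eval x _ = eval x _
    rw [eval_weilShape hx', eval_prod_weilFactor t (a₁ / 5) hx', h]

theorem weilShape_mem_iff {q : ℕ} {a₁ a₂ a₃ a₄ a₅ : ℤ} :
    weilShape q a₁ a₂ a₃ a₄ a₅ ∈ WeilPolys q 5 ↔
      ∃ r : Fin 5 → ℝ, HasRootsIn (a₁ / 5 - 2 * √(q : ℝ)) (a₁ / 5 + 2 * √(q : ℝ))
        (depQuintic (u₂ q a₁ a₂) (u₃ q a₁ a₂ a₃) (u₄ q a₁ a₂ a₃ a₄)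
          (depConst q a₁ a₂ a₃ a₄ a₅)) r := by
  rw [mem_weilPolys_iff]
  constructor
  · rintro ⟨-, t, ht, h⟩
    rw [weilShape_eq_prod_iff] at h
    refine ⟨(fun i => t i + a₁ / 5) ∘ Tuple.sort fun i => t i + (a₁ : ℝ) / 5,
      Tuple.monotone_sort _, fun i => ?_, ?_⟩
    · have := abs_le.1 (ht (Tuple.sort (fun i => t i + (a₁ : ℝ) / 5) i))
      constructor <;> simp only [Function.comp] <;> linarith
    · rw [h]
      exact (Equiv.prod_comp (Tuple.sort fun i => t i + (a₁ : ℝ) / 5)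
        fun i => (X - C (t i + (a₁ : ℝ) / 5))).symm
  · rintro ⟨r, hr⟩
    refine ⟨by norm_num, fun i => r i - a₁ / 5, fun i => ?_, ?_⟩
    · have := hr.mem i
      rw [abs_le]
      constructor <;> linarith
    · rw [weilShape_eq_prod_iff]
      simpa using hr.eq_prod

/-! ### Real roots of Weil polynomials -/

lemma hasRealRoot_iff {h : ℤ[X]} :
    HasRealRoot h ↔ ∃ x : ℝ, (h.map (Int.castRingHom ℝ)).eval x = 0 := by
  unfold HasRealRoot
  simp only [aeval_def, eval_map]
  rfl

/-- A factor `x² - tx + q` with `|t| ≤ 2√q` that has a real root is the square of a linear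
polynomial. -/
lemma weilFactor_root {q : ℕ} {t x : ℝ} (ht : |t| ≤ 2 * √(q : ℝ))
    (hx : (weilFactor q t).eval x = 0) : t = 2 * x ∧ x ^ 2 = q := by
  have h1 := sq_le_sq' (abs_le.1 ht).1 (abs_le.1 ht).2
  rw [mul_pow, Real.sq_sqrt (Nat.cast_nonneg q)] at h1
  simp [weilFactor] at hx
  have h2 : (2 * x - t) ^ 2 ≤ 0 := by nlinarith
  have h3 : 2 * x - t = 0 := pow_eq_zero_iff two_ne_zero |>.1 (le_antisymm h2 (sq_nonneg _))
  have h4 : t = 2 * x := by linarith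
  refine ⟨h4, ?_⟩
  rw [h4] at hx
  linarith

lemma weilFactor_two_mul {q : ℕ} {x : ℝ} (hx : x ^ 2 = q) :
    weilFactor q (2 * x) = (X - C x) ^ 2 := by
  refine Polynomial.funext fun y => ?_
  simp [weilFactor]
  linear_combination -hx

lemma exists_root_factor {q g : ℕ} {t : Fin (g + 1) → ℝ} (ht : ∀ i, |t i| ≤ 2 * √(q : ℝ)) {x : ℝ}
    (hx : (∏ i, weilFactor q (t i)).eval x = 0) :
    x ^ 2 = q ∧ ∃ t' : Fin g → ℝ, (∀ i, |t' i| ≤ 2 * √(q : ℝ)) ∧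
      ∏ i, weilFactor q (t i) = (X - C x) ^ 2 * ∏ i, weilFactor q (t' i) := by
  rw [eval_prod, Finset.prod_eq_zero_iff] at hx
  obtain ⟨i, -, hi⟩ := hx
  obtain ⟨h1, h2⟩ := weilFactor_root (ht i) hi
  refine ⟨h2, fun j => t (i.succAbove j), fun j => ht _, ?_⟩
  rw [Fin.prod_univ_succAbove _ i, h1, weilFactor_two_mul h2]

/-- For `h ∈ W_q(5)`, a real root of `h` is `±√q`, that is, an end point root of the quintic. -/
lemma hasRealRoot_weilShape_iff {q : ℕ} (hq : 0 < q) {a₁ a₂ a₃ a₄ a₅ : ℤ}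
    (h : weilShape q a₁ a₂ a₃ a₄ a₅ ∈ WeilPolys q 5) :
    HasRealRoot (weilShape q a₁ a₂ a₃ a₄ a₅) ↔
      (depQuintic (u₂ q a₁ a₂) (u₃ q a₁ a₂ a₃) (u₄ q a₁ a₂ a₃ a₄)
        (depConst q a₁ a₂ a₃ a₄ a₅)).eval (a₁ / 5 - 2 * √(q : ℝ)) = 0 ∨
      (depQuintic (u₂ q a₁ a₂) (u₃ q a₁ a₂ a₃) (u₄ q a₁ a₂ a₃ a₄)
        (depConst q a₁ a₂ a₃ a₄ a₅)).eval (a₁ / 5 + 2 * √(q : ℝ)) = 0 := by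
  have hR : 0 < √(q : ℝ) := Real.sqrt_pos.2 (by exact_mod_cast hq)
  have hR2 : √(q : ℝ) ^ 2 = q := Real.sq_sqrt (Nat.cast_nonneg q)
  have hdiv : (q : ℝ) / √(q : ℝ) = √(q : ℝ) := Real.div_sqrt
  have hpos := eval_weilShape (q := q) (a₁ := a₁) (a₂ := a₂) (a₃ := a₃) (a₄ := a₄) (a₅ := a₅)
    hR.ne'
  have hneg := eval_weilShape (q := q) (a₁ := a₁) (a₂ := a₂) (a₃ := a₃) (a₄ := a₄) (a₅ := a₅)
    (neg_ne_zero.2 hR.ne')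
  rw [hdiv, show √(q : ℝ) + √(q : ℝ) + a₁ / 5 = a₁ / 5 + 2 * √(q : ℝ) by ring] at hpos
  rw [div_neg, hdiv, show -√(q : ℝ) + -√(q : ℝ) + a₁ / 5 = a₁ / 5 - 2 * √(q : ℝ) by ring] at hneg
  rw [hasRealRoot_iff]
  constructor
  · rintro ⟨x, hx⟩
    obtain ⟨-, t, ht, hprod⟩ := mem_weilPolys_iff.1 h
    have hx2 := (exists_root_factor ht (by rw [← hprod]; exact hx)).1
    rw [← hR2] at hx2
    rcases sq_eq_sq_iff_eq_or_eq_neg.1 hx2 with rfl | rfl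
    · rw [hpos] at hx
      exact Or.inr ((mul_eq_zero.1 hx).resolve_left (pow_ne_zero 5 hR.ne'))
    · rw [hneg] at hx
      exact Or.inl ((mul_eq_zero.1 hx).resolve_left (pow_ne_zero 5 (neg_ne_zero.2 hR.ne')))
  · rintro (h0 | h0)
    · exact ⟨_, by rw [hneg, h0, mul_zero]⟩
    · exact ⟨_, by rw [hpos, h0, mul_zero]⟩

/-- Exact division by a monic integer polynomial, when the real quotient is a Weil polynomial. -/
lemma exists_weil_cofactor {q g : ℕ} (hg : 0 < g) {h m : ℤ[X]} (hm : m.Monic) {t : Fin g → ℝ}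
    (ht : ∀ i, |t i| ≤ 2 * √(q : ℝ))
    (hprod : h.map (Int.castRingHom ℝ)
      = m.map (Int.castRingHom ℝ) * ∏ i, weilFactor q (t i)) :
    ∃ h₀ ∈ WeilPolys q g, h = m * h₀ := by
  obtain ⟨h₀, rfl⟩ := (map_dvd_map _ (Int.cast_injective (α := ℝ)) hm).1 (Dvd.intro _ hprod.symm)
  refine ⟨h₀, mem_weilPolys_iff.2 ⟨hg, t, ht, ?_⟩, rfl⟩
  rw [Polynomial.map_mul] at hprod
  exact mul_left_cancel₀ (hm.map _).ne_zero hprod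

/-- If `q` is not a square, an integer polynomial vanishing at one square root of `q` vanishes at
the other, because its remainder modulo `x² - q` has to be zero. -/
lemma eval_neg_eq_zero_of_not_isSquare {q : ℕ} (hq : ¬ IsSquare q) {h : ℤ[X]} {x : ℝ}
    (hx2 : x ^ 2 = q) (hx : (h.map (Int.castRingHom ℝ)).eval x = 0) :
    (h.map (Int.castRingHom ℝ)).eval (-x) = 0 := by
  have hirr : Irrational x := by
    have h1 : Irrational √(q : ℝ) := irrational_sqrt_natCast_iff.2 hq
    rw [← Real.sq_sqrt (Nat.cast_nonneg q)] at hx2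
    rcases sq_eq_sq_iff_eq_or_eq_neg.1 hx2 with rfl | rfl
    · exact h1
    · exact h1.neg
  have hm : (X ^ 2 - C (q : ℤ)).Monic := monic_X_pow_sub_C _ two_ne_zero
  have hdeg : (h %ₘ (X ^ 2 - C (q : ℤ))).natDegree ≤ 1 := by
    have := natDegree_modByMonic_lt h hm (by
      intro h1
      have := congrArg natDegree h1
      rw [natDegree_X_pow_sub_C] at this
      simp at this)
    rw [natDegree_X_pow_sub_C] at this
    omega
  obtain ⟨a, b, hab⟩ := exists_eq_X_add_C_of_natDegree_le_one hdeg
  have hdecomp := modByMonic_add_div h (X ^ 2 - C (q : ℤ))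
  rw [hab] at hdecomp
  have hval : ∀ y : ℝ, y ^ 2 = q → (h.map (Int.castRingHom ℝ)).eval y = a * y + b := by
    intro y hy
    rw [← hdecomp]
    simp [hy]
  rw [hval x hx2] at hx
  have ha : a = 0 := by
    by_contra ha
    have hirr' := (hirr.intCast_mul ha).add_intCast b
    rw [hx] at hirr'
    exact hirr'.ne_zero rfl
  subst ha
  rw [hval (-x) (by rw [neg_sq, hx2])]
  simpa using hx

lemma prod_cons_weilFactor {q g : ℕ} (x : ℝ) (t : Fin g → ℝ) :
    ∏ i, weilFactor q ((Fin.cons x t : Fin (g + 1) → ℝ) i)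
      = weilFactor q x * ∏ i, weilFactor q (t i) := by
  rw [Fin.prod_univ_succ]; simp

theorem mem_and_hasRealRoot_iff {q : ℕ} {h : ℤ[X]} :
    h ∈ WeilPolys q 5 ∧ HasRealRoot h ↔ CaseI q h ∨ CaseII q h := by
  rw [hasRealRoot_iff]
  constructor
  · rintro ⟨hW, x, hx⟩
    obtain ⟨-, t, ht, hprod⟩ := mem_weilPolys_iff.1 hW
    obtain ⟨hx2, t', ht', hprod'⟩ := exists_root_factor ht (by rw [← hprod]; exact hx)
    rw [hprod'] at hprod
    by_cases hsq : IsSquare q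
    · left
      obtain ⟨r, rfl⟩ := hsq
      have hxr : x ^ 2 = (r : ℝ) ^ 2 := by rw [hx2]; push_cast; ring
      rcases sq_eq_sq_iff_eq_or_eq_neg.1 hxr with rfl | rfl
      · obtain ⟨h₀, hh₀, he⟩ := exists_weil_cofactor (m := (X - C (r : ℤ)) ^ 2) (by norm_num)
          ((monic_X_sub_C _).pow 2) ht' (by simpa using hprod)
        exact ⟨r, by ring, h₀, hh₀, Or.inr he⟩
      · obtain ⟨h₀, hh₀, he⟩ := exists_weil_cofactor (m := (X + C (r : ℤ)) ^ 2) (by norm_num)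
          ((monic_X_add_C _).pow 2) ht' (by simpa using hprod)
        exact ⟨r, by ring, h₀, hh₀, Or.inl he⟩
    · right
      have hx0 : x ≠ 0 := by
        rintro rfl
        apply hsq
        have : q = 0 := by
          have : (q : ℝ) = 0 := by rw [← hx2]; norm_num
          exact_mod_cast this
        rw [this]; exact IsSquare.zero
      have hneg := eval_neg_eq_zero_of_not_isSquare hsq hx2 hx
      rw [hprod, eval_mul] at hneg
      have hneg' := (mul_eq_zero.1 hneg).resolve_left (by
        simp only [eval_pow, eval_sub, eval_X, eval_C]
        refine pow_ne_zero 2 fun h0 => hx0 ?_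
        linarith)
      obtain ⟨-, t'', ht'', hprod''⟩ := exists_root_factor ht' hneg'
      obtain ⟨h₀, hh₀, he⟩ := exists_weil_cofactor (m := (X ^ 2 - C (q : ℤ)) ^ 2) (by norm_num)
        ((monic_X_pow_sub_C _ two_ne_zero).pow 2) ht'' (by
          rw [hprod, hprod'', ← mul_assoc]
          congr 1
          refine Polynomial.funext fun y => ?_
          simp [← hx2]
          ring)
      exact ⟨hsq, h₀, hh₀, he⟩
  · rintro (⟨r, rfl, h₀, hh₀, he⟩ | ⟨-, h₀, hh₀, rfl⟩)
    · obtain ⟨-, t, ht, hprod⟩ := mem_weilPolys_iff.1 hh₀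
      rcases he with rfl | rfl
      · refine ⟨mem_weilPolys_iff.2 ⟨by norm_num, Fin.cons (2 * -(r : ℝ)) t, ?_, ?_⟩, -r, by simp⟩
        · intro i
          cases i using Fin.cases with
          | zero => simp
          | succ i => exact ht i
        · rw [prod_cons_weilFactor, weilFactor_two_mul (by push_cast; ring), ← hprod]
          simp
      · refine ⟨mem_weilPolys_iff.2 ⟨by norm_num, Fin.cons (2 * (r : ℝ)) t, ?_, ?_⟩, r, by simp⟩
        · intro i
          cases i using Fin.cases with
          | zero => simp
          | succ i => exact ht i
        · rw [prod_cons_weilFactor, weilFactor_two_mul (by push_cast; ring), ← hprod]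
          simp
    · obtain ⟨-, t, ht, hprod⟩ := mem_weilPolys_iff.1 hh₀
      have hR2 : √(q : ℝ) ^ 2 = q := Real.sq_sqrt (Nat.cast_nonneg q)
      refine ⟨mem_weilPolys_iff.2 ⟨by norm_num,
        Fin.cons (2 * √(q : ℝ)) (Fin.cons (2 * -√(q : ℝ)) t), ?_, ?_⟩, √(q : ℝ), by simp [hR2]⟩
      · intro i
        cases i using Fin.cases with
        | zero => simp [abs_of_nonneg (Real.sqrt_nonneg _)]
        | succ i =>
          cases i using Fin.cases with
          | zero => simp [abs_of_nonneg (Real.sqrt_nonneg _)]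
          | succ i => exact ht i
      · rw [prod_cons_weilFactor, prod_cons_weilFactor, weilFactor_two_mul hR2,
          weilFactor_two_mul (by rw [neg_sq, hR2]), ← hprod, ← mul_assoc, Polynomial.map_mul]
        congr 1
        refine Polynomial.funext fun y => ?_
        simp
        linear_combination (2 * y ^ 2 - √(q : ℝ) ^ 2 - q) * hR2

lemma not_caseI_and_caseII {q : ℕ} {h : ℤ[X]} : ¬ (CaseI q h ∧ CaseII q h) := by
  rintro ⟨⟨r, hr, -⟩, hns, -⟩
  exact hns ⟨r, by rw [hr, sq]⟩

/-! ### Characterization of the Weil polynomials of degree ten -/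

theorem theoremC (q : ℕ) (hq : IsPrimePow q) (a₁ a₂ a₃ a₄ a₅ : ℤ) (h : Polynomial ℤ)
    (hh : h = weilShape q a₁ a₂ a₃ a₄ a₅)
    (S : Multiset ℂ) (hS : IsCardanoSet (u₂ q a₁ a₂) (u₃ q a₁ a₂ a₃) S)
    (X : Multiset ℂ)
    (hX : IsFerrariSet (u₂ q a₁ a₂) (u₃ q a₁ a₂ a₃) (u₄ q a₁ a₂ a₃ a₄) X) :
    -- the quantity between parentheses in (c) is non-negative by (b)
    (CondB q a₁ a₂ → 0 ≤ radicandC q a₁ a₂) ∧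
    -- the elements of `S` are real numbers `θ₁ ≤ θ₂ ≤ θ₃`
    (h ∈ WeilPolys q 5 ∨ CondsAToD q a₁ a₂ a₃ →
      ∃ θ : Fin 3 → ℝ, IsSortedListing S θ) ∧
    -- the elements of `X` are real numbers `γ₁ ≤ γ₂ ≤ γ₃ ≤ γ₄`
    (h ∈ WeilPolys q 5 ∨
        (CondsAToD q a₁ a₂ a₃ ∧
          (∃ θ : Fin 3 → ℝ, IsSortedListing S θ ∧ CondE q a₁ a₂ a₃ a₄ (θ 0) (θ 1)) ∧
          CondF q a₁ a₂ a₃ a₄) →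
      ∃ γ : Fin 4 → ℝ, IsSortedListing X γ) ∧
    -- `h` is in `W_q(5)` if and only if (a)-(h) hold
    (h ∈ WeilPolys q 5 ↔
      CondsAToD q a₁ a₂ a₃ ∧
        (∃ θ : Fin 3 → ℝ, IsSortedListing S θ ∧ CondE q a₁ a₂ a₃ a₄ (θ 0) (θ 1)) ∧
        CondF q a₁ a₂ a₃ a₄ ∧
        CondG q a₁ a₂ a₃ a₄ a₅ ∧
        ∃ γ : Fin 4 → ℝ, IsSortedListing X γ ∧ CondH q a₁ a₂ a₃ a₄ a₅ γ) ∧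
    -- a polynomial `h` in `W_q(5)` has a real root if and only if some inequality is an equality
    (h ∈ WeilPolys q 5 → (HasRealRoot h ↔ SomeEquality q a₁ a₂ a₃ a₄ a₅)) ∧
    -- the explicit description, by mutually exclusive cases
    (h ∈ WeilPolys q 5 ∧ HasRealRoot h ↔ CaseI q h ∨ CaseII q h) ∧
    ¬ (CaseI q h ∧ CaseII q h) := by
  have hq0 : (0 : ℝ) ≤ q := Nat.cast_nonneg q
  subst hh
  have hW4 : weilShape q a₁ a₂ a₃ a₄ a₅ ∈ WeilPolys q 5 →
      CondsAToD q a₁ a₂ a₃ ∧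
        (∃ θ : Fin 3 → ℝ, IsSortedListing S θ ∧ CondE q a₁ a₂ a₃ a₄ (θ 0) (θ 1)) ∧
        CondF q a₁ a₂ a₃ a₄ := fun hW => by
    obtain ⟨hD, hE, hF, -⟩ := (condsAToH_iff hq0 hS hX).2 (weilShape_mem_iff.1 hW)
    exact ⟨hD, hE, hF⟩
  refine ⟨radicandC_nonneg, fun h => ?_, fun h => ?_, ?_, fun hW => ?_, mem_and_hasRealRoot_iff,
    not_caseI_and_caseII⟩
  · obtain ⟨τ, hτ⟩ := (condsAToD_iff hq0).1 (h.elim (fun hW => (hW4 hW).1) id)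
    exact ⟨_, isSortedListing_critValue hS hτ⟩
  · obtain ⟨γ, hγ⟩ := (condsAToF_iff hq0 hS).1 (h.elim hW4 id)
    exact ⟨γ, hγ.isSortedListing_ferrari hX⟩
  · rw [weilShape_mem_iff, ← condsAToH_iff hq0 hS hX]
  · obtain ⟨r, hr⟩ := weilShape_mem_iff.1 hW
    rw [someEquality_iff hq0 hr, hasRealRoot_weilShape_iff hq.pos hW]
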